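/- Consider a slotted two-hop status update system with a source, a relay and a destination. The state at the beginning of a slot is $(k,d)$, where $k$ is the age of information (AoI) at the relay and $d$ is the age gain, so that the AoI at the destination is $k+d$; the state space is $\mathcal V=\{(k,d): k\ge 2,\ d=0\}\cup\{(k,d): k\ge 1,\ d\ge 2\}$. If the relay receives, then $(k,d)$ moves to $(1,k+d)$ if the source-relay transmission succeeds and to $(k+1,d)$ otherwise; if the relay forwards, then $(k,d)$ moves to $(k+1,0)$ if the relay-destination transmission succeeds and to $(k+1,d)$ otherwise. In every slot, independently of the other slots, the two links succeed with probability $p\in(0,1]$ and $q\in(0,1]$ respectively. Under the double threshold relaying (DTR) policy with integer thresholds $\delta_1\ge 1$ and $\delta_2\ge 2$, the relay forwards if $k\le\delta_1$ and $d\ge\delta_2$, and receives otherwise. Theorem. The Markov chain $(k,d)$ under the DTR policy has a unique stationary distribution $\pi$ on $\mathcal V$, and, from every initial state in $\mathcal V$, the long-run average AoI at the destination $\bar\Delta=\limsup_{T\to\infty}\frac1T\mathbb E\big[\sum_{t=1}^T (k(t)+d(t))\big]$ is a limit and equals the convergent sum $\sum_{k,d}(k+d)\pi_{k,d}$. Moreover: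 (i) If $\delta_1\le\delta_2-1$, then exactly $$\bar\Delta=\frac1q+\frac1{p[1-(1-q)^{\delta_1}]}+\frac{\delta_1+\delta_2}2-\frac{[\delta_2+(1-p)\delta_1+p\delta_1\delta_2]/2}{(1-p)+p\delta_2-p(\delta_2-\delta_1-1)(1-q)^{\delta_1}}.$$ (ii) If $\delta_1\ge\delta_2-1$, then $\bar\Delta\approx\tilde\Delta$, where, with $D=q(1-p)+pq\delta_2+p(1-q)^{\delta_2-1}-p(1-q)^{\delta_1}$, $$\tilde\Delta=\frac1p+\frac1q+\delta_2-\frac{(p\delta_1-q\delta_2)(1-q)^{\delta_1}+q\delta_2\big[\frac{p(\delta_2-1)}2+1\big]+1}{D}+\frac{\big[1-(1-q)^{\delta_2-1}\big]\Big[p(p\delta_1-q\delta_1-q)(1-q)^{\delta_1}+p-q-pq\delta_1+\frac{q(p\delta_1+1)}{1-(1-q)^{\delta_1}}\Big]}{p\big[1-(1-q)^{\delta_1}\big]D},$$ in the following sense. Put $x=pq^2/D$ and, for $k\ge1$ and $d\ge\delta_2$, let $n=\lfloor (d-\delta_2)/(\delta_1+1)\rfloor$, $m=(d-\delta_2)\bmod(\delta_1+1)$,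 $N_l=(n-l)(\delta_1+1)+m+1$, $$\tilde\pi_{k,d}=c_k\,\frac{p[1-(1-q)^{\delta_2-1}]}{q}\,x\sum_{l=0}^n\frac{(N_l+l-1)!}{l!\,(N_l-1)!}\big[p(1-q)^{\delta_1}\big]^l(1-p)^{N_l-1},$$ where $c_k=(1-q)^{k-1}$ for $k\le\delta_1+1$ and $c_k=(1-q)^{\delta_1}(1-p)^{k-\delta_1-1}$ for $k\ge\delta_1+1$; these $\tilde\pi_{k,d}$ approximate $\pi_{k,d}$. Then $\tilde\Delta$ is the sum $\sum_{k,d}(k+d)\pi_{k,d}$ with $\pi_{k,d}$ replaced by $\tilde\pi_{k,d}$ in the contribution of the excess of $d$ over $\delta_2$: $$\tilde\Delta=\sum_{k,d}\big(k+\min(d,\delta_2)\big)\pi_{k,d}+\sum_{k\ge1,\,d\ge\delta_2}(d-\delta_2)\,\tilde\pi_{k,d}.$$ The approximation becomes exact as $q\to1$: for fixed $p,\delta_1,\delta_2$, $\bar\Delta-\tilde\Delta\to0$ as $q\to1^-$, and $\bar\Delta=\tilde\Delta$ at $q=1$. -/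

import Mathlib

open MeasureTheory ProbabilityTheory Filter Topology
open scoped Nat

/-! Two-hop status update system.  A state is a pair `(k, d)`: `k` is the age of information (AoI)
at the relay, `d` is the age gain, so that `k + d` is the AoI at the destination. -/

/-- The set of states: `k ≥ 2, d = 0`, or `k ≥ 1, d ≥ 2`. -/
def aoiStates : Set (ℕ × ℕ) :=
  {v | (2 ≤ v.1 ∧ v.2 = 0) ∨ (1 ≤ v.1 ∧ 2 ≤ v.2)}

/-- One slot of the age dynamics.  The action `w` is `true` for forwarding and `false` for
receiving; `sr`, `rd` say whether a source-relay, respectively relay-destination, transmission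
in this slot is successful. -/
def ageStep (w sr rd : Bool) (v : ℕ × ℕ) : ℕ × ℕ :=
  (if w = false ∧ sr = true then 0 + 1 else v.1 + 1,
   if w = true ∧ rd = true then 0
   else if w = false ∧ sr = true then v.1 + v.2
   else v.2)

/-- The state process under the stationary policy `θ`, driven by the success indicators of the
links.  Slots are numbered from `0`, and `v₀` is the state at the beginning of the first slot. -/
def stateProcess {Ω : Type*} (θ : ℕ × ℕ → Bool) (ISR IRD : ℕ → Ω → Bool) (v₀ : ℕ × ℕ) :
    ℕ → Ω → ℕ × ℕ
  | 0, _ => v₀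
  | t + 1, ω =>
      ageStep (θ (stateProcess θ ISR IRD v₀ t ω)) (ISR t ω) (IRD t ω)
        (stateProcess θ ISR IRD v₀ t ω)

/-- The error-prone links: in every slot the source-relay link succeeds with probability `p` and
the relay-destination link with probability `q`, independently of the other slots.  (Only one of
the links is used in a slot, so nothing is required of the two indicators of one slot jointly.) -/
structure IsLinkModel {Ω : Type*} [MeasurableSpace Ω] (μ : Measure Ω) (p q : ℝ)
    (ISR IRD : ℕ → Ω → Bool) : Prop where
  measurable_sr : ∀ t, Measurable (ISR t)
  measurable_rd : ∀ t, Measurable (IRD t)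
  prob_sr : ∀ t, μ {ω | ISR t ω = true} = ENNReal.ofReal p
  prob_rd : ∀ t, μ {ω | IRD t ω = true} = ENNReal.ofReal q
  indep : iIndepFun (fun t ω => (ISR t ω, IRD t ω)) μ

/-- The AoI at the destination in slot `t`. -/
def destAge {Ω : Type*} (θ : ℕ × ℕ → Bool) (ISR IRD : ℕ → Ω → Bool) (v₀ : ℕ × ℕ)
    (t : ℕ) (ω : Ω) : ℝ :=
  ((stateProcess θ ISR IRD v₀ t ω).1 : ℝ) + ((stateProcess θ ISR IRD v₀ t ω).2 : ℝ)

/-- The expected time average of the AoI at the destination over the first `T` slots. -/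
noncomputable def meanAge {Ω : Type*} [MeasurableSpace Ω] (μ : Measure Ω)
    (θ : ℕ × ℕ → Bool) (ISR IRD : ℕ → Ω → Bool) (v₀ : ℕ × ℕ) (T : ℕ) : ℝ :=
  1 / (T : ℝ) * ∫ ω, ∑ t ∈ Finset.range T, destAge θ ISR IRD v₀ t ω ∂μ

/-- The long-run average AoI at the destination. -/
noncomputable def averageAoI {Ω : Type*} [MeasurableSpace Ω] (μ : Measure Ω)
    (θ : ℕ × ℕ → Bool) (ISR IRD : ℕ → Ω → Bool) (v₀ : ℕ × ℕ) : ℝ :=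
  limsup (fun T : ℕ => meanAge μ θ ISR IRD v₀ T) atTop

/-- The double threshold relaying (DTR) policy: forward exactly if `k ≤ δ₁` and `d ≥ δ₂`. -/
def dtrPolicy (δ₁ δ₂ : ℕ) (v : ℕ × ℕ) : Bool :=
  decide (v.1 ≤ δ₁ ∧ δ₂ ≤ v.2)

/-- The transition probability from `v` to `v'` of the Markov chain of the DTR policy. -/
noncomputable def dtrTransition (p q : ℝ) (δ₁ δ₂ : ℕ) (v v' : ℕ × ℕ) : ℝ :=
  if v.1 ≤ δ₁ ∧ δ₂ ≤ v.2 then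
    (if v' = (v.1 + 1, 0) then q else 0) + (if v' = (v.1 + 1, v.2) then 1 - q else 0)
  else
    (if v' = (1, v.1 + v.2) then p else 0) + (if v' = (v.1 + 1, v.2) then 1 - p else 0)

/-- `π` is a stationary probability distribution of the DTR Markov chain on `aoiStates`. -/
structure IsDTRStationary (p q : ℝ) (δ₁ δ₂ : ℕ) (π : ℕ × ℕ → ℝ) : Prop where
  nonneg : ∀ v, 0 ≤ π v
  support : ∀ v, v ∉ aoiStates → π v = 0
  total : HasSum π 1
  balance : ∀ v', HasSum (fun v => π v * dtrTransition p q δ₁ δ₂ v v') (π v')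

/-- The probability of the state `(2, 0)` in the case `δ₂ - 1 ≤ δ₁`. -/
noncomputable def dtrX (p q : ℝ) (δ₁ δ₂ : ℕ) : ℝ :=
  p * q ^ 2 /
    (q * (1 - p) + p * q * δ₂ + p * (1 - q) ^ (δ₂ - 1) * (1 - (1 - q) ^ (δ₁ + 1 - δ₂)))

/-- The probability of the state `(1, δ₂)` in the case `δ₂ - 1 ≤ δ₁`. -/
noncomputable def dtrInitial (p q : ℝ) (δ₁ δ₂ : ℕ) : ℝ :=
  p * (1 - (1 - q) ^ (δ₂ - 1)) / q * dtrX p q δ₁ δ₂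

/-- The number `N = (n - l)(δ₁ + 1) + m + 1`, where `n` and `m` are the quotient and the remainder
of `d - δ₂` by `δ₁ + 1`. -/
def dtrN (δ₁ δ₂ d l : ℕ) : ℕ :=
  ((d - δ₂) / (δ₁ + 1) - l) * (δ₁ + 1) + (d - δ₂) % (δ₁ + 1) + 1

/-- The approximate probability of the state `(1, d)`, `d ≥ δ₂`, in the case `δ₂ - 1 ≤ δ₁`. -/
noncomputable def dtrApproxRow (p q : ℝ) (δ₁ δ₂ d : ℕ) : ℝ :=
  dtrInitial p q δ₁ δ₂ *
    ∑ l ∈ Finset.range ((d - δ₂) / (δ₁ + 1) + 1),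
      ((dtrN δ₁ δ₂ d l + l - 1)! : ℝ) / ((l ! : ℝ) * ((dtrN δ₁ δ₂ d l - 1)! : ℝ))
        * (p * (1 - q) ^ δ₁) ^ l * (1 - p) ^ (dtrN δ₁ δ₂ d l - 1)

/-- The approximate probability of the state `(k, d)`, `k ≥ 1`, `d ≥ δ₂`, in the case
`δ₂ - 1 ≤ δ₁` (and `0` at all other `(k, d)`). -/
noncomputable def dtrApprox (p q : ℝ) (δ₁ δ₂ : ℕ) (v : ℕ × ℕ) : ℝ :=
  if 1 ≤ v.1 ∧ δ₂ ≤ v.2 then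
    if v.1 ≤ δ₁ + 1 then (1 - q) ^ (v.1 - 1) * dtrApproxRow p q δ₁ δ₂ v.2
    else (1 - q) ^ δ₁ * (1 - p) ^ (v.1 - δ₁ - 1) * dtrApproxRow p q δ₁ δ₂ v.2
  else 0

/-- The closed form for `δ₂ - 1 ≤ δ₁` (approximate). -/
noncomputable def aoiApproxFormula (p q : ℝ) (δ₁ δ₂ : ℕ) : ℝ :=
  1 / p + 1 / q + δ₂
    - ((p * δ₁ - q * δ₂) * (1 - q) ^ δ₁ + q * δ₂ * (p * (δ₂ - 1) / 2 + 1) + 1)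
      / (q * (1 - p) + p * q * δ₂ + p * (1 - q) ^ (δ₂ - 1) - p * (1 - q) ^ δ₁)
    + ((1 - (1 - q) ^ (δ₂ - 1))
        * (p * (p * δ₁ - q * δ₁ - q) * (1 - q) ^ δ₁ + p - q - p * q * δ₁
            + q * (p * δ₁ + 1) / (1 - (1 - q) ^ δ₁)))
      / (p * (1 - (1 - q) ^ δ₁)
          * (q * (1 - p) + p * q * δ₂ + p * (1 - q) ^ (δ₂ - 1) - p * (1 - q) ^ δ₁))

/-- The closed form for `δ₁ ≤ δ₂ - 1` (exact). -/
noncomputable def aoiExactFormula (p q : ℝ) (δ₁ δ₂ : ℕ) : ℝ :=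
  1 / q + 1 / (p * (1 - (1 - q) ^ δ₁)) + ((δ₁ : ℝ) + δ₂) / 2
    - ((δ₂ + (1 - p) * δ₁ + p * δ₁ * δ₂) / 2)
      / ((1 - p) + p * δ₂ - p * ((δ₂ : ℝ) - δ₁ - 1) * (1 - q) ^ δ₁)

/-! Let `P` be the transition operator on functions and `K` its version killed on entering `(2, 0)`.
From any state a run of successes of bounded length ends in `(2, 0)`, so the probability of avoiding
`(2, 0)` for `t` slots decays geometrically, uniformly in the start (`survival_geometric`). The
total age grows by at most one per slot, hence `∑ K^t g` converges for every `g` of linear growth.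
The ratio of the expected sum of `g` over a cycle to the mean cycle length is then an invariant mean
(`stationaryMean_dtrOp`), and its values at indicators form the stationary distribution. The centred
potential solves Poisson's equation `h - P h = g - c`; integrating it gives uniqueness, and
telescoping it gives convergence of the time averages from every start.

The closed forms use Poisson's equation backwards: a solution of linear growth identifies `c` as the
mean (`stationaryMean_eq_of_poisson`). For the cost `k + min d b + θ (d - b)⁺` a solution is
explicit. It depends only on the total age while `d < b`, and is affine in `d - b` otherwise. In the
forwarding region it obeys a first-order recursion in `k`, and one linear matching condition at `k =
1` fixes `c`.

The choice `θ = 1` gives the true mean age in both cases, and `θ = 0` the mean of `k + min d b`. The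
approximate formula is the `θ = 0` mean plus a negative-binomial series for the excess. Since the
true mean is explicit as well, exactness as `q → 1` is continuity at `q = 1`. -/

/-- The transition operator of the DTR chain, acting on functions of the state. -/
noncomputable def dtrOp (p q : ℝ) (a b : ℕ) : Module.End ℝ (ℕ × ℕ → ℝ) where
  toFun g v :=
    if v.1 ≤ a ∧ b ≤ v.2 then q * g (v.1 + 1, 0) + (1 - q) * g (v.1 + 1, v.2)
    else p * g (1, v.1 + v.2) + (1 - p) * g (v.1 + 1, v.2)
  map_add' g g' := by
    funext v
    simp only [Pi.add_apply]
    split_ifs <;> ring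
  map_smul' c g := by
    funext v
    simp only [Pi.smul_apply, smul_eq_mul, RingHom.id_apply]
    split_ifs <;> ring

/-- The projection that forgets the value at the regeneration state `(2, 0)`. -/
noncomputable def killAt : Module.End ℝ (ℕ × ℕ → ℝ) where
  toFun g v := if v = (2, 0) then 0 else g v
  map_add' g g' := by
    funext v
    simp only [Pi.add_apply]
    split_ifs <;> ring
  map_smul' c g := by
    funext v
    simp only [Pi.smul_apply, smul_eq_mul, RingHom.id_apply]
    split_ifs <;> ring

/-- The transition operator killed on entering the regeneration state `(2, 0)`. -/
noncomputable def dtrKilled (p q : ℝ) (a b : ℕ) : Module.End ℝ (ℕ × ℕ → ℝ) :=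
  dtrOp p q a b * killAt

/-- The total age `k + d` of a state, as a real number. -/
def totalAge (v : ℕ × ℕ) : ℝ := (v.1 : ℝ) + v.2

/-- Functions of at most linear growth in the total age. -/
def LinGrowth (g : ℕ × ℕ → ℝ) : Prop := ∃ A : ℝ, 0 ≤ A ∧ ∀ v, |g v| ≤ A * (totalAge v + 1)

lemma totalAge_nonneg (v : ℕ × ℕ) : 0 ≤ totalAge v := by unfold totalAge; positivity

/-! ### The killed operator and geometric decay of the survival probability. -/

section Operators

variable {p q : ℝ} {a b : ℕ}

lemma dtrOp_apply_forward (g : ℕ × ℕ → ℝ) {v : ℕ × ℕ} (hv : v.1 ≤ a ∧ b ≤ v.2) :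
    dtrOp p q a b g v = q * g (v.1 + 1, 0) + (1 - q) * g (v.1 + 1, v.2) := if_pos hv

lemma dtrOp_apply_receive (g : ℕ × ℕ → ℝ) {v : ℕ × ℕ} (hv : ¬ (v.1 ≤ a ∧ b ≤ v.2)) :
    dtrOp p q a b g v = p * g (1, v.1 + v.2) + (1 - p) * g (v.1 + 1, v.2) := if_neg hv

lemma killAt_apply (g : ℕ × ℕ → ℝ) (v : ℕ × ℕ) : killAt g v = if v = (2, 0) then 0 else g v := rfl

lemma dtrKilled_apply (g : ℕ × ℕ → ℝ) : dtrKilled p q a b g = dtrOp p q a b (killAt g) := rfl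

/-- One slot raises the total age by at most one, so a comparison on that range suffices. This
locality lets a linear bound be replaced by its value at `v`. -/
lemma dtrOp_mono_of (hp0 : 0 ≤ p) (hp1 : p ≤ 1) (hq0 : 0 ≤ q) (hq1 : q ≤ 1)
    {g g' : ℕ × ℕ → ℝ} {v : ℕ × ℕ} (h : ∀ w, totalAge w ≤ totalAge v + 1 → g w ≤ g' w) :
    dtrOp p q a b g v ≤ dtrOp p q a b g' v := by
  have h1 : g (v.1 + 1, 0) ≤ g' (v.1 + 1, 0) := h _ (by simp [totalAge])
  have h2 : g (v.1 + 1, v.2) ≤ g' (v.1 + 1, v.2) := h _ (by simp [totalAge]; linarith)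
  have h3 : g (1, v.1 + v.2) ≤ g' (1, v.1 + v.2) := h _ (by simp [totalAge]; linarith)
  have := sub_nonneg.2 hp1
  have := sub_nonneg.2 hq1
  by_cases hv : v.1 ≤ a ∧ b ≤ v.2
  · rw [dtrOp_apply_forward _ hv, dtrOp_apply_forward _ hv]; gcongr
  · rw [dtrOp_apply_receive _ hv, dtrOp_apply_receive _ hv]; gcongr

lemma dtrOp_mono (hp0 : 0 ≤ p) (hp1 : p ≤ 1) (hq0 : 0 ≤ q) (hq1 : q ≤ 1) :
    Monotone (dtrOp p q a b) := fun _ _ h _ =>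
  dtrOp_mono_of hp0 hp1 hq0 hq1 fun w _ => h w

lemma dtrOp_const (c : ℝ) : dtrOp p q a b (fun _ => c) = fun _ => c := by
  funext v
  by_cases hv : v.1 ≤ a ∧ b ≤ v.2
  · rw [dtrOp_apply_forward _ hv]; ring
  · rw [dtrOp_apply_receive _ hv]; ring

lemma killAt_mono : Monotone killAt := by
  intro g g' h v
  simp only [killAt_apply]
  split_ifs
  · exact le_rfl
  · exact h v

lemma killAt_le {g : ℕ × ℕ → ℝ} (hg : 0 ≤ g) : killAt g ≤ g := by
  intro v
  rw [killAt_apply]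
  split_ifs
  · exact hg v
  · exact le_rfl

lemma dtrKilled_mono (hp0 : 0 ≤ p) (hp1 : p ≤ 1) (hq0 : 0 ≤ q) (hq1 : q ≤ 1) :
    Monotone (dtrKilled p q a b) := fun _ _ h => dtrOp_mono hp0 hp1 hq0 hq1 (killAt_mono h)

lemma dtrKilled_le (hp0 : 0 ≤ p) (hp1 : p ≤ 1) (hq0 : 0 ≤ q) (hq1 : q ≤ 1)
    {g : ℕ × ℕ → ℝ} (hg : 0 ≤ g) : dtrKilled p q a b g ≤ dtrOp p q a b g :=
  dtrOp_mono hp0 hp1 hq0 hq1 (killAt_le hg)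

lemma dtrOp_eq_killed_add (g : ℕ × ℕ → ℝ) (v : ℕ × ℕ) :
    dtrOp p q a b g v = dtrKilled p q a b g v
      + g (2, 0) * dtrOp p q a b (Pi.single (2, 0) 1) v := by
  have : g = killAt g + g (2, 0) • Pi.single (2, 0) 1 := by
    funext w
    simp only [Pi.add_apply, killAt_apply, Pi.smul_apply, smul_eq_mul]
    by_cases hw : w = (2, 0)
    · subst hw; simp
    · simp [hw]
  conv_lhs => rw [this]
  rw [map_add, map_smul]
  rfl

lemma pow_succ_apply_end (T : Module.End ℝ (ℕ × ℕ → ℝ)) (t : ℕ) (g : ℕ × ℕ → ℝ) :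
    (T ^ (t + 1)) g = T ((T ^ t) g) := by rw [pow_succ']; rfl

lemma pow_succ_apply_end' (T : Module.End ℝ (ℕ × ℕ → ℝ)) (t : ℕ) (g : ℕ × ℕ → ℝ) :
    (T ^ (t + 1)) g = (T ^ t) (T g) := by rw [pow_succ]; rfl

lemma pow_mono_end {T : Module.End ℝ (ℕ × ℕ → ℝ)} (hT : Monotone T) (t : ℕ) :
    Monotone (T ^ t : Module.End ℝ (ℕ × ℕ → ℝ)) := by
  induction t with
  | zero => rw [pow_zero]; exact monotone_id
  | succ t ih =>
    intro g g' h
    rw [pow_succ_apply_end, pow_succ_apply_end]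
    exact hT (ih h)

/-- The probability of not having entered `(2, 0)` in `t` slots. -/
noncomputable def survival (p q : ℝ) (a b t : ℕ) : ℕ × ℕ → ℝ := (dtrKilled p q a b ^ t) 1

lemma survival_succ (t : ℕ) :
    survival p q a b (t + 1) = dtrKilled p q a b (survival p q a b t) :=
  pow_succ_apply_end _ _ _

lemma survival_nonneg (hp0 : 0 ≤ p) (hp1 : p ≤ 1) (hq0 : 0 ≤ q) (hq1 : q ≤ 1) (t : ℕ) :
    0 ≤ survival p q a b t := by
  have := pow_mono_end (dtrKilled_mono (a := a) (b := b) hp0 hp1 hq0 hq1) t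
    (show (0 : ℕ × ℕ → ℝ) ≤ 1 from zero_le_one)
  simpa [survival] using this

lemma survival_antitone (hp0 : 0 ≤ p) (hp1 : p ≤ 1) (hq0 : 0 ≤ q) (hq1 : q ≤ 1) :
    Antitone (survival p q a b) := by
  refine antitone_nat_of_succ_le fun t => ?_
  unfold survival
  rw [pow_succ_apply_end']
  refine pow_mono_end (dtrKilled_mono hp0 hp1 hq0 hq1) t ?_
  refine (dtrKilled_le hp0 hp1 hq0 hq1 zero_le_one).trans ?_
  exact (dtrOp_const (p := p) (q := q) (a := a) (b := b) 1).le

lemma survival_le_one (hp0 : 0 ≤ p) (hp1 : p ≤ 1) (hq0 : 0 ≤ q) (hq1 : q ≤ 1) (t : ℕ) (v : ℕ × ℕ) :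
    survival p q a b t v ≤ 1 := by
  have := survival_antitone (a := a) (b := b) hp0 hp1 hq0 hq1 (Nat.zero_le t) v
  simpa [survival] using this

/-- One-step bound on the survival probability, given bounds at the two successors. -/
lemma survival_forward_le (hp0 : 0 ≤ p) (hp1 : p ≤ 1) (hq0 : 0 ≤ q) (hq1 : q ≤ 1)
    {t : ℕ} {v : ℕ × ℕ} {c : ℝ} (hv : v.1 ≤ a ∧ b ≤ v.2) (hc : killAt (survival p q a b t) (v.1 + 1, 0) ≤ c) :
    survival p q a b (t + 1) v ≤ 1 - q * (1 - c) := by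
  rw [survival_succ, dtrKilled_apply, dtrOp_apply_forward _ hv]
  have h1 := (killAt_le (survival_nonneg (a := a) (b := b) hp0 hp1 hq0 hq1 t) (v.1 + 1, v.2)).trans
    (survival_le_one hp0 hp1 hq0 hq1 t _)
  have h2 := mul_le_mul_of_nonneg_left hc hq0
  have h3 := mul_le_mul_of_nonneg_left h1 (sub_nonneg.2 hq1)
  linarith

lemma survival_receive_le (hp0 : 0 ≤ p) (hp1 : p ≤ 1) (hq0 : 0 ≤ q) (hq1 : q ≤ 1)
    {t : ℕ} {v : ℕ × ℕ} {c : ℝ} (hv : ¬ (v.1 ≤ a ∧ b ≤ v.2))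
    (hc : survival p q a b t (1, v.1 + v.2) ≤ c) :
    survival p q a b (t + 1) v ≤ 1 - p * (1 - c) := by
  rw [survival_succ, dtrKilled_apply, dtrOp_apply_receive _ hv]
  have h1 := (killAt_le (survival_nonneg (a := a) (b := b) hp0 hp1 hq0 hq1 t) (v.1 + 1, v.2)).trans
    (survival_le_one hp0 hp1 hq0 hq1 t _)
  have h2 := mul_le_mul_of_nonneg_left
    ((killAt_le (survival_nonneg (a := a) (b := b) hp0 hp1 hq0 hq1 t) (1, v.1 + v.2)).trans hc) hp0
  have h3 := mul_le_mul_of_nonneg_left h1 (sub_nonneg.2 hp1)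
  linarith

/-- The relay forwards at `(1, d)`, and a success leads exactly to the killed state `(2, 0)`. -/
lemma survival_loaded_le (hp0 : 0 ≤ p) (hp1 : p ≤ 1) (hq0 : 0 ≤ q) (hq1 : q ≤ 1) (ha : 1 ≤ a)
    {t d : ℕ} (hd : b ≤ d) : survival p q a b (t + 1) (1, d) ≤ 1 - q := by
  refine (survival_forward_le hp0 hp1 hq0 hq1 ⟨ha, hd⟩ (c := 0) ?_).trans (by linarith)
  simp [killAt_apply]

/-- Below the threshold the relay receives, and a success moves `(k, d)` to `(1, k + d)`, whose
total age is larger by one. So `n + 1` receptions suffice to load the relay, and one forwarding from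
`k = 1` then enters `(2, 0)`. -/
lemma survival_unloaded_le (hp0 : 0 ≤ p) (hp1 : p ≤ 1) (hq0 : 0 ≤ q) (hq1 : q ≤ 1) (ha : 1 ≤ a)
    (n : ℕ) : ∀ (t k d : ℕ), d < b → b ≤ k + d + n →
      survival p q a b (t + n + 2) (k, d) ≤ 1 - p ^ (n + 1) * q := by
  induction n with
  | zero =>
    intro t k d hd hs
    refine (survival_receive_le hp0 hp1 hq0 hq1 (by simp; omega) (c := 1 - q) ?_).trans
      (le_of_eq (by ring))
    exact survival_loaded_le hp0 hp1 hq0 hq1 ha hs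
  | succ n ih =>
    intro t k d hd hs
    have key : survival p q a b (t + n + 2) (1, k + d) ≤ 1 - p ^ (n + 1) * q := by
      by_cases hkd : b ≤ k + d
      · refine (survival_loaded_le hp0 hp1 hq0 hq1 ha (t := t + n + 1) hkd).trans ?_
        have := mul_le_mul_of_nonneg_right (pow_le_one₀ (n := n + 1) hp0 hp1) hq0
        linarith
      · exact ih t 1 (k + d) (by omega) (by omega)
    refine (survival_receive_le hp0 hp1 hq0 hq1 (by simp; omega) key).trans ?_
    rw [pow_succ p (n + 1)]
    exact le_of_eq (by ring)

/-- Doeblin's condition: the state `(2, 0)` is entered within `b + 3` slots with a probability that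
is bounded below. -/
lemma survival_uniform_le (hp0 : 0 ≤ p) (hp1 : p ≤ 1) (hq0 : 0 ≤ q) (hq1 : q ≤ 1) (ha : 1 ≤ a)
    (hb : 1 ≤ b) (v : ℕ × ℕ) :
    survival p q a b (b + 3) v ≤ 1 - p ^ (b + 1) * q ^ 2 := by
  obtain ⟨k, d⟩ := v
  have hpp : p ^ (b + 1) ≤ 1 := pow_le_one₀ hp0 hp1
  have hpp0 : 0 ≤ p ^ (b + 1) := by positivity
  have hun : ∀ k d, d < b → survival p q a b (b + 2) (k, d) ≤ 1 - p ^ (b + 1) * q := by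
    intro k d hd
    simpa using survival_unloaded_le hp0 hp1 hq0 hq1 ha b 0 k d hd (by omega)
  have hmono : survival p q a b (b + 3) (k, d) ≤ survival p q a b (b + 2) (k, d) :=
    survival_antitone hp0 hp1 hq0 hq1 (by omega) _
  -- Three starts: unloaded; loaded with `k ≤ a`, where one success empties the relay; loaded with
  -- `k > a`, where one success leads to a loaded state with `k = 1`.
  by_cases hd : d < b
  · have := hun k d hd
    nlinarith [mul_nonneg hpp0 hq0, mul_le_mul_of_nonneg_left hq1 (mul_nonneg hpp0 hq0)]
  · by_cases hk : k ≤ a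
    · refine (survival_forward_le hp0 hp1 hq0 hq1 (t := b + 2) (v := (k, d)) ⟨hk, not_lt.1 hd⟩
        (c := 1 - p ^ (b + 1) * q) ?_).trans (le_of_eq (by ring))
      exact (killAt_le (survival_nonneg hp0 hp1 hq0 hq1 _) _).trans (hun _ _ hb)
    · refine (survival_receive_le hp0 hp1 hq0 hq1 (t := b + 2) (v := (k, d)) (by simp; omega)
        (c := 1 - q) (survival_loaded_le hp0 hp1 hq0 hq1 ha (t := b + 1) (by omega))).trans ?_
      have h1 : p ^ (b + 1) ≤ p := pow_le_of_le_one hp0 hp1 (by omega)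
      have h2 : q ^ 2 ≤ q := pow_le_of_le_one hq0 hq1 (by omega)
      have := mul_le_mul h1 h2 (by positivity) hp0
      linarith

/-- Submultiplicativity: the uniform bound over the last `M` slots is a constant, which the positive
operator `K^t` lets through. -/
lemma survival_add_le (hp0 : 0 ≤ p) (hp1 : p ≤ 1) (hq0 : 0 ≤ q) (hq1 : q ≤ 1) {M : ℕ} {ρ : ℝ}
    (hρ : ∀ v, survival p q a b M v ≤ ρ) (t : ℕ) (v : ℕ × ℕ) :
    survival p q a b (t + M) v ≤ ρ * survival p q a b t v := by
  have h : (dtrKilled p q a b ^ t) (survival p q a b M) ≤ (dtrKilled p q a b ^ t) (ρ • 1) :=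
    pow_mono_end (dtrKilled_mono hp0 hp1 hq0 hq1) t fun w => by simpa using hρ w
  have h2 := h v
  rw [map_smul] at h2
  unfold survival at *
  rw [pow_add]
  exact h2

/-- The survival probability decays geometrically, uniformly in the initial state. -/
lemma survival_geometric (hp0 : 0 < p) (hp1 : p ≤ 1) (hq0 : 0 < q) (hq1 : q ≤ 1) (ha : 1 ≤ a)
    (hb : 1 ≤ b) : ∃ C r : ℝ, 0 < C ∧ 0 < r ∧ r < 1 ∧
      ∀ t v, survival p q a b t v ≤ C * r ^ t := by
  -- Half of the Doeblin constant, so that `1 - ε` stays positive even for `p = q = 1`.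
  set ε : ℝ := p ^ (b + 1) * q ^ 2 / 2 with hε
  have hε0 : 0 < ε := by positivity
  have hε1 : ε < 1 := by
    have : p ^ (b + 1) * q ^ 2 ≤ 1 :=
      mul_le_one₀ (pow_le_one₀ hp0.le hp1) (by positivity) (pow_le_one₀ hq0.le hq1)
    rw [hε]; linarith
  set M := b + 3
  set r : ℝ := (1 - ε) ^ ((M : ℝ)⁻¹) with hr
  have hρ0 : 0 < 1 - ε := by linarith
  have hr0 : 0 < r := Real.rpow_pos_of_pos hρ0 _
  have hr1 : r < 1 := Real.rpow_lt_one hρ0.le (by linarith) (by positivity)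
  have hrM : r ^ M = 1 - ε := Real.rpow_inv_natCast_pow hρ0.le (by omega)
  have hstep : ∀ v, survival p q a b M v ≤ 1 - ε := fun v =>
    (survival_uniform_le hp0.le hp1 hq0.le hq1 ha hb v).trans (by rw [hε]; nlinarith)
  refine ⟨(1 - ε)⁻¹, r, by positivity, hr0, hr1, fun t v => ?_⟩
  induction t using Nat.strong_induction_on with
  | _ t ih =>
    by_cases ht : t < M
    · refine (survival_le_one hp0.le hp1 hq0.le hq1 t v).trans ?_
      rw [inv_mul_eq_div, le_div_iff₀ hρ0, one_mul, ← hrM]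
      exact pow_le_pow_of_le_one hr0.le hr1.le ht.le
    · obtain ⟨s, rfl⟩ := Nat.exists_eq_add_of_le' (not_lt.1 ht)
      refine (survival_add_le hp0.le hp1 hq0.le hq1 hstep s v).trans ?_
      refine (mul_le_mul_of_nonneg_left (ih s (by omega)) hρ0.le).trans (le_of_eq ?_)
      rw [pow_add, hrM]; ring

/-- Powers of the killed operator on functions of linear growth. -/
lemma abs_killed_pow_le (hp0 : 0 ≤ p) (hp1 : p ≤ 1) (hq0 : 0 ≤ q) (hq1 : q ≤ 1)
    {g : ℕ × ℕ → ℝ} {A : ℝ} (hA : 0 ≤ A) (hg : ∀ v, |g v| ≤ A * (totalAge v + 1)) (t : ℕ) :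
    ∀ v, |(dtrKilled p q a b ^ t) g v| ≤ A * (totalAge v + t + 1) * survival p q a b t v := by
  induction t with
  | zero => intro v; simpa [survival] using hg v
  | succ t ih =>
    intro v
    -- One-sided form, applied to `f` and to `-f`. On the successors of `v` the linear factor is at
    -- most its value for `v` at time `t + 1`, which is a constant and leaves the operator.
    have key : ∀ f : ℕ × ℕ → ℝ, (∀ w, f w ≤ A * (totalAge w + t + 1) * survival p q a b t w) →
        dtrKilled p q a b f v ≤ A * (totalAge v + (t + 1 : ℕ) + 1) * survival p q a b (t + 1) v := by
      intro f hf
      have h1 : dtrOp p q a b (killAt f) v ≤ dtrOp p q a b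
          ((A * (totalAge v + (t + 1 : ℕ) + 1)) • killAt (survival p q a b t)) v := by
        refine dtrOp_mono_of hp0 hp1 hq0 hq1 fun w hw => ?_
        simp only [Pi.smul_apply, killAt_apply, smul_eq_mul]
        split_ifs
        · simp
        · refine (hf w).trans ?_
          have := survival_nonneg (a := a) (b := b) hp0 hp1 hq0 hq1 t w
          refine mul_le_mul_of_nonneg_right (mul_le_mul_of_nonneg_left ?_ hA) this
          push_cast; linarith
      rw [map_smul] at h1
      rw [survival_succ]
      exact h1
    rw [pow_succ_apply_end, abs_le']
    refine ⟨key _ fun w => (le_abs_self _).trans (ih w), ?_⟩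
    have := key (-((dtrKilled p q a b ^ t) g)) fun w => (neg_le_abs _).trans (ih w)
    rwa [map_neg] at this

end Operators

/-! ### Potentials over a regeneration cycle and Poisson's equation. -/

section Potential

variable {p q : ℝ} {a b : ℕ}

/-- The expected sum of `g` until the state `(2, 0)` is entered. -/
noncomputable def potential (p q : ℝ) (a b : ℕ) (g : ℕ × ℕ → ℝ) (v : ℕ × ℕ) : ℝ :=
  ∑' t, (dtrKilled p q a b ^ t) g v

lemma linGrowth_const (c : ℝ) : LinGrowth fun _ => c :=
  ⟨|c|, abs_nonneg _, fun v => by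
    have := mul_nonneg (abs_nonneg c) (totalAge_nonneg v); linarith⟩

lemma linGrowth_of_abs_le {g : ℕ × ℕ → ℝ} {c : ℝ} (h : ∀ v, |g v| ≤ c) : LinGrowth g :=
  ⟨|c|, abs_nonneg _, fun v => by
    have := mul_nonneg (abs_nonneg c) (totalAge_nonneg v)
    have := h v
    have := le_abs_self c
    linarith⟩

lemma linGrowth_totalAge : LinGrowth totalAge :=
  ⟨1, zero_le_one, fun v => by rw [abs_of_nonneg (totalAge_nonneg v)]; linarith⟩

lemma LinGrowth.add {g g' : ℕ × ℕ → ℝ} (h : LinGrowth g) (h' : LinGrowth g') :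
    LinGrowth (g + g') := by
  obtain ⟨A, hA, hg⟩ := h
  obtain ⟨A', hA', hg'⟩ := h'
  refine ⟨A + A', by positivity, fun v => (abs_add_le _ _).trans ?_⟩
  rw [add_mul]
  exact add_le_add (hg v) (hg' v)

lemma LinGrowth.neg {g : ℕ × ℕ → ℝ} (h : LinGrowth g) : LinGrowth (-g) := by
  obtain ⟨A, hA, hg⟩ := h
  exact ⟨A, hA, fun v => by simpa using hg v⟩

lemma LinGrowth.sub {g g' : ℕ × ℕ → ℝ} (h : LinGrowth g) (h' : LinGrowth g') :
    LinGrowth (g - g') := by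
  rw [sub_eq_add_neg]; exact h.add h'.neg

lemma LinGrowth.abs {g : ℕ × ℕ → ℝ} (h : LinGrowth g) : LinGrowth |g| := by
  obtain ⟨A, hA, hg⟩ := h
  exact ⟨A, hA, fun v => by simpa using hg v⟩

lemma linGrowth_single (w : ℕ × ℕ) : LinGrowth (Pi.single w 1) :=
  linGrowth_of_abs_le (c := 1) fun v => by
    by_cases h : v = w
    · subst h; simp
    · simp [h]

lemma LinGrowth.dtrOp (hp0 : 0 ≤ p) (hp1 : p ≤ 1) (hq0 : 0 ≤ q) (hq1 : q ≤ 1)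
    {g : ℕ × ℕ → ℝ} (h : LinGrowth g) : LinGrowth (dtrOp p q a b g) := by
  obtain ⟨A, hA, hg⟩ := h
  have key : ∀ f : ℕ × ℕ → ℝ, (∀ w, f w ≤ A * (totalAge w + 1)) → ∀ v,
      _root_.dtrOp p q a b f v ≤ (2 * A) * (totalAge v + 1) := by
    intro f hf v
    have := dtrOp_mono_of (a := a) (b := b) (g := f) (g' := fun _ => A * (totalAge v + 2)) (v := v)
      hp0 hp1 hq0 hq1 fun w hw => (hf w).trans (mul_le_mul_of_nonneg_left (by linarith) hA)
    rw [dtrOp_const] at this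
    refine this.trans ?_
    nlinarith [mul_nonneg hA (totalAge_nonneg v)]
  refine ⟨2 * A, by positivity, fun v => abs_le'.2 ⟨key g (fun w => (le_abs_self _).trans (hg w)) v, ?_⟩⟩
  have := key (-g) (fun w => (neg_le_abs _).trans (hg w)) v
  rwa [map_neg] at this

lemma LinGrowth.killAt {g : ℕ × ℕ → ℝ} (h : LinGrowth g) : LinGrowth (killAt g) := by
  obtain ⟨A, hA, hg⟩ := h
  refine ⟨A, hA, fun v => ?_⟩
  rw [killAt_apply]
  split_ifs
  · have := totalAge_nonneg v
    rw [abs_zero]; positivity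
  · exact hg v

lemma LinGrowth.killed (hp0 : 0 ≤ p) (hp1 : p ≤ 1) (hq0 : 0 ≤ q) (hq1 : q ≤ 1)
    {g : ℕ × ℕ → ℝ} (h : LinGrowth g) : LinGrowth (dtrKilled p q a b g) :=
  h.killAt.dtrOp hp0 hp1 hq0 hq1

variable (hp0 : 0 < p) (hp1 : p ≤ 1) (hq0 : 0 < q) (hq1 : q ≤ 1) (ha : 1 ≤ a) (hb : 1 ≤ b)
include hp0 hp1 hq0 hq1 ha hb

/-- The linear growth in `t` is absorbed by the geometric decay. A single summable sequence serves
all `g` and all starts, the dependence on these being the factor `A * (totalAge v + 1)`. -/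
lemma exists_killed_bound : ∃ u : ℕ → ℝ, (Summable u) ∧ (∀ t, 0 ≤ u t) ∧
    ∀ (g : ℕ × ℕ → ℝ) (A : ℝ), 0 ≤ A → (∀ v, |g v| ≤ A * (totalAge v + 1)) →
      ∀ t v, |(dtrKilled p q a b ^ t) g v| ≤ A * (totalAge v + 1) * u t := by
  obtain ⟨C, r, hC, hr0, hr1, h⟩ := survival_geometric (a := a) (b := b) hp0 hp1 hq0 hq1 ha hb
  refine ⟨fun t => C * (((t : ℝ) ^ 1 * r ^ t) + r ^ t), ?_, fun t => by positivity, ?_⟩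
  · refine Summable.mul_left _ (Summable.add ?_ (summable_geometric_of_lt_one hr0.le hr1))
    exact summable_pow_mul_geometric_of_norm_lt_one 1 (by rwa [Real.norm_of_nonneg hr0.le])
  · intro g A hA hg t v
    refine (abs_killed_pow_le hp0.le hp1 hq0.le hq1 hA hg t v).trans ?_
    have h1 := totalAge_nonneg v
    have h2 : totalAge v + t + 1 ≤ (totalAge v + 1) * (t + 1) := by
      have : 0 ≤ totalAge v * t := by positivity
      linarith
    calc A * (totalAge v + t + 1) * survival p q a b t v
        ≤ A * ((totalAge v + 1) * (t + 1)) * (C * r ^ t) :=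
          mul_le_mul (mul_le_mul_of_nonneg_left h2 hA) (h t v)
            (survival_nonneg hp0.le hp1 hq0.le hq1 t v) (by positivity)
      _ = _ := by ring

lemma summable_killed {g : ℕ × ℕ → ℝ} (hg : LinGrowth g) (v : ℕ × ℕ) :
    Summable fun t => (dtrKilled p q a b ^ t) g v := by
  obtain ⟨u, hu, -, h⟩ := exists_killed_bound hp0 hp1 hq0 hq1 ha hb
  obtain ⟨A, hA, hg⟩ := hg
  exact Summable.of_norm_bounded (hu.mul_left _) fun t => h g A hA hg t v

lemma LinGrowth.potential {g : ℕ × ℕ → ℝ} (hg : LinGrowth g) :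
    LinGrowth (potential p q a b g) := by
  obtain ⟨u, hu, hu0, h⟩ := exists_killed_bound hp0 hp1 hq0 hq1 ha hb
  obtain ⟨A, hA, hg⟩ := hg
  refine ⟨A * ∑' t, u t, mul_nonneg hA (tsum_nonneg hu0), fun v => ?_⟩
  have := tsum_of_norm_bounded (f := fun t => (dtrKilled p q a b ^ t) g v)
    (hu.mul_left (A * (totalAge v + 1))).hasSum fun t => h g A hA hg t v
  rw [tsum_mul_left] at this
  refine this.trans (le_of_eq (by ring))

lemma potential_sub {g g' : ℕ × ℕ → ℝ} (hg : LinGrowth g) (hg' : LinGrowth g') :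
    potential p q a b (g - g') = potential p q a b g - potential p q a b g' := by
  funext v
  simp only [potential, map_sub, Pi.sub_apply]
  exact (summable_killed hp0 hp1 hq0 hq1 ha hb hg v).tsum_sub
    (summable_killed hp0 hp1 hq0 hq1 ha hb hg' v)

omit hp0 hp1 hq0 hq1 ha hb in
lemma potential_smul (c : ℝ) (g : ℕ × ℕ → ℝ) :
    potential p q a b (c • g) = c • potential p q a b g := by
  funext v
  simp only [potential, map_smul, Pi.smul_apply, smul_eq_mul]
  exact tsum_mul_left

/-- Here the extra factor of `K` is placed next to `g`. In `potential_eq_add_killed` it is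
outermost, which needs `K` to commute with the infinite sum; it does, because `K` reads only two
successors. -/
lemma potential_eq_add {g : ℕ × ℕ → ℝ} (hg : LinGrowth g) (v : ℕ × ℕ) :
    potential p q a b g v = g v + potential p q a b (dtrKilled p q a b g) v := by
  unfold potential
  rw [(summable_killed hp0 hp1 hq0 hq1 ha hb hg v).tsum_eq_zero_add]
  simp only [pow_zero, Module.End.one_apply, pow_succ_apply_end']

lemma potential_eq_add_killed {g : ℕ × ℕ → ℝ} (hg : LinGrowth g) (v : ℕ × ℕ) :
    potential p q a b g v = g v + dtrKilled p q a b (potential p q a b g) v := by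
  have hs := summable_killed hp0 hp1 hq0 hq1 ha hb hg
  have hk : ∀ w, HasSum (fun t => killAt ((dtrKilled p q a b ^ t) g) w)
      (killAt (potential p q a b g) w) := by
    intro w
    simp only [killAt_apply]
    split_ifs
    · exact hasSum_zero
    · exact (hs w).hasSum
  have : HasSum (fun t => (dtrKilled p q a b ^ (t + 1)) g v)
      (dtrKilled p q a b (potential p q a b g) v) := by
    simp only [pow_succ_apply_end, dtrKilled_apply]
    by_cases hv : v.1 ≤ a ∧ b ≤ v.2
    · simp only [dtrOp_apply_forward _ hv]
      exact ((hk _).mul_left q).add ((hk _).mul_left (1 - q))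
    · simp only [dtrOp_apply_receive _ hv]
      exact ((hk _).mul_left p).add ((hk _).mul_left (1 - p))
  conv_lhs => rw [potential, (hs v).tsum_eq_zero_add, this.tsum_eq]
  simp

omit ha hb in
lemma potential_nonneg {g : ℕ × ℕ → ℝ} (hg : 0 ≤ g) : 0 ≤ potential p q a b g := fun v =>
  tsum_nonneg fun t => by
    simpa using pow_mono_end (dtrKilled_mono (a := a) (b := b) hp0.le hp1 hq0.le hq1) t hg v

lemma le_potential {g : ℕ × ℕ → ℝ} (hg0 : 0 ≤ g) (hg : LinGrowth g) : g ≤ potential p q a b g := by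
  intro v
  rw [potential_eq_add hp0 hp1 hq0 hq1 ha hb hg v]
  have : 0 ≤ dtrKilled p q a b g := by
    simpa using dtrKilled_mono (a := a) (b := b) hp0.le hp1 hq0.le hq1 hg0
  have := potential_nonneg (a := a) (b := b) hp0 hp1 hq0 hq1 this v
  simp only [Pi.zero_apply] at this
  linarith

/-- The mean length of a regeneration cycle. -/
lemma one_le_potential_one (v : ℕ × ℕ) : 1 ≤ potential p q a b 1 v :=
  le_potential hp0 hp1 hq0 hq1 ha hb zero_le_one (linGrowth_const 1) v

/-- The stationary mean of `g`. -/
noncomputable def stationaryMean (p q : ℝ) (a b : ℕ) (g : ℕ × ℕ → ℝ) : ℝ :=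
  potential p q a b g (2, 0) / potential p q a b 1 (2, 0)

/-- Entering `(2, 0)` is certain. -/
lemma potential_entrance (v : ℕ × ℕ) :
    potential p q a b (dtrOp p q a b (Pi.single (2, 0) 1)) v = 1 := by
  -- The one-step entrance probability is `1 - K 1`, so its potential telescopes.
  have h1 : dtrOp p q a b (Pi.single (2, 0) 1) = 1 - dtrKilled p q a b 1 := by
    funext w
    have := dtrOp_eq_killed_add (p := p) (q := q) (a := a) (b := b) 1 w
    have h := congrFun (dtrOp_const (p := p) (q := q) (a := a) (b := b) 1) w
    change dtrOp p q a b 1 w = 1 at h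
    simp only [Pi.one_apply, one_mul, Pi.sub_apply] at this ⊢
    linarith
  have hL : LinGrowth (1 : ℕ × ℕ → ℝ) := linGrowth_const 1
  rw [h1, potential_sub hp0 hp1 hq0 hq1 ha hb hL (hL.killed hp0.le hp1 hq0.le hq1)]
  have := potential_eq_add hp0 hp1 hq0 hq1 ha hb hL v
  simp only [Pi.sub_apply, Pi.one_apply] at this ⊢
  linarith

/-- Write `P g` as `K g` plus `g (2, 0)` times the entrance probability. The potential of `K g`
misses the initial term `g (2, 0)` of the cycle, and the certain entrance at its end restores it. -/
lemma stationaryMean_dtrOp {g : ℕ × ℕ → ℝ} (hg : LinGrowth g) :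
    stationaryMean p q a b (dtrOp p q a b g) = stationaryMean p q a b g := by
  have h1 : dtrOp p q a b g = dtrKilled p q a b g
      - (-g (2, 0)) • dtrOp p q a b (Pi.single (2, 0) 1) := by
    funext w
    have := dtrOp_eq_killed_add (p := p) (q := q) (a := a) (b := b) g w
    simp only [Pi.sub_apply, Pi.smul_apply, smul_eq_mul]
    linarith
  have hs : LinGrowth ((-g (2, 0)) • dtrOp p q a b (Pi.single (2, 0) 1)) := by
    rw [← map_smul]
    refine LinGrowth.dtrOp hp0.le hp1 hq0.le hq1 ?_
    refine linGrowth_of_abs_le (c := |g (2, 0)|) fun v => ?_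
    by_cases h : v = (2, 0)
    · subst h; simp
    · simp [h]
  unfold stationaryMean
  congr 1
  rw [h1, potential_sub hp0 hp1 hq0 hq1 ha hb (hg.killed hp0.le hp1 hq0.le hq1) hs,
    potential_smul]
  simp only [Pi.sub_apply, Pi.smul_apply, potential_entrance hp0 hp1 hq0 hq1 ha hb, smul_eq_mul]
  have := potential_eq_add hp0 hp1 hq0 hq1 ha hb hg (2, 0)
  linarith

/-- Poisson's equation. -/
lemma potential_poisson {g : ℕ × ℕ → ℝ} (hg : LinGrowth g) (v : ℕ × ℕ) :
    potential p q a b (g - fun _ => stationaryMean p q a b g) v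
      - dtrOp p q a b (potential p q a b (g - fun _ => stationaryMean p q a b g)) v
      = g v - stationaryMean p q a b g := by
  set c := stationaryMean p q a b g with hc
  have hL : LinGrowth (g - fun _ => c) := hg.sub (linGrowth_const c)
  -- The centred potential vanishes at `(2, 0)`, so killing there has no effect on it and `K` may be
  -- replaced by `P`.
  have h0 : potential p q a b (g - fun _ => c) (2, 0) = 0 := by
    have h1 : (fun _ => c : ℕ × ℕ → ℝ) = c • 1 := by funext v; simp
    rw [potential_sub hp0 hp1 hq0 hq1 ha hb hg (linGrowth_const c), h1, potential_smul]
    simp only [Pi.sub_apply, Pi.smul_apply, smul_eq_mul]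
    have := one_le_potential_one (a := a) (b := b) hp0 hp1 hq0 hq1 ha hb (2, 0)
    rw [hc, stationaryMean]
    field_simp
    ring
  rw [dtrOp_eq_killed_add, h0, potential_eq_add_killed hp0 hp1 hq0 hq1 ha hb hL v]
  simp

omit hp0 hp1 hq0 hq1 ha hb in
lemma hasSum_dtrOp {ι : Type*} {f : ι → ℕ × ℕ → ℝ} {g : ℕ × ℕ → ℝ}
    (h : ∀ w, HasSum (fun i => f i w) (g w)) (v : ℕ × ℕ) :
    HasSum (fun i => dtrOp p q a b (f i) v) (dtrOp p q a b g v) := by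
  by_cases hv : v.1 ≤ a ∧ b ≤ v.2
  · simp only [dtrOp_apply_forward _ hv]
    exact ((h _).mul_left q).add ((h _).mul_left (1 - q))
  · simp only [dtrOp_apply_receive _ hv]
    exact ((h _).mul_left p).add ((h _).mul_left (1 - p))

omit hp0 hp1 hq0 hq1 ha hb in
lemma hasSum_killAt {ι : Type*} {f : ι → ℕ × ℕ → ℝ} {g : ℕ × ℕ → ℝ}
    (h : ∀ w, HasSum (fun i => f i w) (g w)) (v : ℕ × ℕ) :
    HasSum (fun i => killAt (f i) v) (killAt g v) := by
  simp only [killAt_apply]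
  split_ifs
  · exact hasSum_zero
  · exact h v

omit hp0 hp1 hq0 hq1 ha hb in
lemma hasSum_single_smul (g : ℕ × ℕ → ℝ) (v : ℕ × ℕ) :
    HasSum (fun w => (g w • Pi.single w 1 : ℕ × ℕ → ℝ) v) (g v) := by
  have := hasSum_single (f := fun w => (g w • Pi.single w 1 : ℕ × ℕ → ℝ) v) v (fun w hw => by
    simp [hw.symm])
  simpa using this

omit hp0 hp1 hq0 hq1 ha hb in
/-- Expansion of a power of the killed operator in the indicators of the states. -/
lemma hasSum_killed_pow (g : ℕ × ℕ → ℝ) (t : ℕ) (v : ℕ × ℕ) :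
    HasSum (fun w => (dtrKilled p q a b ^ t) (Pi.single w 1) v * g w)
      ((dtrKilled p q a b ^ t) g v) := by
  have : HasSum (fun w => (dtrKilled p q a b ^ t) (g w • Pi.single w 1) v)
      ((dtrKilled p q a b ^ t) g v) := by
    induction t generalizing v with
    | zero => simpa using hasSum_single_smul g v
    | succ t ih =>
      simp only [pow_succ_apply_end, dtrKilled_apply]
      exact hasSum_dtrOp (hasSum_killAt ih) v
  simpa [map_smul, mul_comm] using this

/-- The stationary distribution. -/
noncomputable def stationaryDist (p q : ℝ) (a b : ℕ) (v : ℕ × ℕ) : ℝ :=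
  stationaryMean p q a b (Pi.single v 1)

/-- Fubini for the double series over slots and states; the potential of `|g|` provides absolute
convergence. -/
lemma hasSum_stationaryDist {g : ℕ × ℕ → ℝ} (hg : LinGrowth g) :
    HasSum (fun v => stationaryDist p q a b v * g v) (stationaryMean p q a b g) := by
  have hn : ∀ t w, 0 ≤ (dtrKilled p q a b ^ t) (Pi.single w 1) (2, 0) := fun t w => by
    have := pow_mono_end (dtrKilled_mono (a := a) (b := b) hp0.le hp1 hq0.le hq1) t
      (show (0 : ℕ × ℕ → ℝ) ≤ Pi.single w 1 from Pi.single_nonneg.2 zero_le_one) (2, 0)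
    simpa using this
  set F : ℕ × (ℕ × ℕ) → ℝ := fun x => (dtrKilled p q a b ^ x.1) (Pi.single x.2 1) (2, 0) * g x.2
    with hF
  have hsum : Summable F := by
    rw [← summable_abs_iff]
    rw [summable_prod_of_nonneg fun x => abs_nonneg _]
    have hE : ∀ t, HasSum (fun w => |F (t, w)|) ((dtrKilled p q a b ^ t) |g| (2, 0)) := by
      intro t
      have := hasSum_killed_pow (p := p) (q := q) (a := a) (b := b) |g| t (2, 0)
      simpa only [hF, abs_mul, abs_of_nonneg (hn _ _), Pi.abs_apply] using this
    refine ⟨fun t => (hE t).summable, ?_⟩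
    simp only [(hE _).tsum_eq]
    exact summable_killed hp0 hp1 hq0 hq1 ha hb hg.abs _
  have h1 : HasSum F (potential p q a b g (2, 0)) := by
    have h2 := hsum.hasSum.prod_fiberwise fun t => hasSum_killed_pow g t (2, 0)
    have h3 : HasSum (fun t => (dtrKilled p q a b ^ t) g (2, 0)) (potential p q a b g (2, 0)) :=
      (summable_killed hp0 hp1 hq0 hq1 ha hb hg _).hasSum
    rw [h3.unique h2]
    exact hsum.hasSum
  have h4 : HasSum (F ∘ Prod.swap) (potential p q a b g (2, 0)) :=
    (Equiv.prodComm _ _).hasSum_iff.2 h1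
  have h5 := h4.prod_fiberwise (g := fun w => potential p q a b (Pi.single w 1) (2, 0) * g w)
    fun w => ((summable_killed hp0 hp1 hq0 hq1 ha hb (linGrowth_single w) (2, 0)).hasSum).mul_right _
  have h6 := h5.div_const (potential p q a b 1 (2, 0))
  have h7 : (fun v => stationaryDist p q a b v * g v) = fun v =>
      potential p q a b (Pi.single v 1) (2, 0) * g v / potential p q a b 1 (2, 0) := by
    funext v
    rw [stationaryDist, stationaryMean]
    ring
  rw [h7]
  exact h6

end Potential

/-! ### Existence and uniqueness of the stationary distribution. -/

section Stationary

variable {p q : ℝ} {a b : ℕ}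

lemma dtrTransition_eq (v v' : ℕ × ℕ) :
    dtrTransition p q a b v v' = dtrOp p q a b (Pi.single v' 1) v := by
  unfold dtrTransition
  by_cases h : v.1 ≤ a ∧ b ≤ v.2
  · rw [dtrOp_apply_forward _ h, if_pos h]
    simp only [Pi.single_apply, mul_ite, mul_one, mul_zero, eq_comm (b := v')]
  · rw [dtrOp_apply_receive _ h, if_neg h]
    simp only [Pi.single_apply, mul_ite, mul_one, mul_zero, eq_comm (b := v')]

lemma dtrOp_congr_on_aoiStates (hb : 2 ≤ b) {g g' : ℕ × ℕ → ℝ} (h : ∀ w ∈ aoiStates, g w = g' w)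
    {v : ℕ × ℕ} (hv : v ∈ aoiStates) : dtrOp p q a b g v = dtrOp p q a b g' v := by
  simp only [aoiStates, Set.mem_ofPred_eq] at hv
  by_cases hf : v.1 ≤ a ∧ b ≤ v.2
  · rw [dtrOp_apply_forward _ hf, dtrOp_apply_forward _ hf, h _ (by simp [aoiStates]; omega),
      h (v.1 + 1, v.2) (by simp [aoiStates]; omega)]
  · rw [dtrOp_apply_receive _ hf, dtrOp_apply_receive _ hf, h _ (by simp [aoiStates]; omega),
      h (v.1 + 1, v.2) (by simp [aoiStates]; omega)]

/-- The state space is closed under the dynamics, so a cycle from `(2, 0)` never sees values outside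
it. This gives the support of the stationary distribution. -/
lemma killed_pow_eq_zero_on_aoiStates (hb : 2 ≤ b) {g : ℕ × ℕ → ℝ} (h : ∀ w ∈ aoiStates, g w = 0)
    (t : ℕ) : ∀ v ∈ aoiStates, (dtrKilled p q a b ^ t) g v = 0 := by
  induction t with
  | zero => simpa using h
  | succ t ih =>
    intro v hv
    rw [pow_succ_apply_end, dtrKilled_apply, dtrOp_congr_on_aoiStates hb (g' := 0) ?_ hv]
    · simp
    · intro w hw
      rw [killAt_apply, ih w hw]
      simp

lemma hasSum_dtrTransition_mul (g : ℕ × ℕ → ℝ) (v : ℕ × ℕ) :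
    HasSum (fun v' => dtrTransition p q a b v v' * g v') (dtrOp p q a b g v) := by
  have := hasSum_dtrOp (p := p) (q := q) (a := a) (b := b) (fun w => hasSum_single_smul g w) v
  simpa only [map_smul, Pi.smul_apply, smul_eq_mul, dtrTransition_eq, mul_comm] using this

lemma dtrTransition_nonneg (hp0 : 0 ≤ p) (hp1 : p ≤ 1) (hq0 : 0 ≤ q) (hq1 : q ≤ 1)
    (v v' : ℕ × ℕ) : 0 ≤ dtrTransition p q a b v v' := by
  have := sub_nonneg.2 hp1
  have := sub_nonneg.2 hq1
  unfold dtrTransition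
  split_ifs <;> positivity

/-- A stationary distribution integrates `dtrOp g` and `g` to the same value. -/
lemma IsDTRStationary.hasSum_dtrOp_sub {π : ℕ × ℕ → ℝ} (hπ : IsDTRStationary p q a b π)
    (hp0 : 0 ≤ p) (hp1 : p ≤ 1) (hq0 : 0 ≤ q) (hq1 : q ≤ 1) {g : ℕ × ℕ → ℝ} {C : ℝ}
    (hg : ∀ v, |g v| ≤ C) :
    HasSum (fun v => π v * (g v - dtrOp p q a b g v)) 0 := by
  have hT := dtrTransition_nonneg (a := a) (b := b) hp0 hp1 hq0 hq1
  have hbdd : ∀ f : ℕ × ℕ → ℝ, (∀ v, |f v| ≤ C) → Summable fun v => π v * f v := fun f hf =>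
    Summable.of_norm_bounded (hπ.total.summable.mul_right C) fun v => by
      rw [norm_mul, Real.norm_of_nonneg (hπ.nonneg v)]
      exact mul_le_mul_of_nonneg_left (hf v) (hπ.nonneg v)
  set F : (ℕ × ℕ) × (ℕ × ℕ) → ℝ := fun x => π x.1 * (dtrTransition p q a b x.1 x.2 * g x.2) with hF
  have hsum : Summable F := by
    rw [← summable_abs_iff, summable_prod_of_nonneg fun x => abs_nonneg _]
    have hE : ∀ v, HasSum (fun v' => |F (v, v')|) (π v * dtrOp p q a b |g| v) := by
      intro v
      have := (hasSum_dtrTransition_mul (p := p) (q := q) (a := a) (b := b) |g| v).mul_left (π v)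
      simpa only [hF, abs_mul, abs_of_nonneg (hπ.nonneg _), abs_of_nonneg (hT _ _),
        Pi.abs_apply] using this
    refine ⟨fun v => (hE v).summable, ?_⟩
    simp only [(hE _).tsum_eq]
    refine hbdd _ fun v => ?_
    have h1 := dtrOp_mono (a := a) (b := b) hp0 hp1 hq0 hq1
      (show |g| ≤ fun _ => C from fun w => hg w) v
    have h2 := dtrOp_mono (a := a) (b := b) hp0 hp1 hq0 hq1 (abs_nonneg g) v
    rw [dtrOp_const] at h1
    rw [map_zero] at h2
    rwa [abs_of_nonneg h2]
  have h1 := hsum.hasSum.prod_fiberwise fun v => (hasSum_dtrTransition_mul g v).mul_left (π v)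
  have h2 : HasSum (F ∘ Prod.swap) (∑' x, F x) := (Equiv.prodComm _ _).hasSum_iff.2 hsum.hasSum
  have h3 := h2.prod_fiberwise (g := fun v' => π v' * g v') fun v' => by
    have := (hπ.balance v').mul_right (g v')
    simpa only [hF, Function.comp_apply, Prod.swap, mul_assoc] using this
  have h4 := h3.sub h1
  simpa only [sub_self, mul_sub] using h4

/-- Boundedness is needed for uniqueness: an arbitrary stationary distribution is not known in
advance to integrate functions of linear growth. -/
lemma potential_bounded (hp0 : 0 < p) (hp1 : p ≤ 1) (hq0 : 0 < q) (hq1 : q ≤ 1) (ha : 1 ≤ a)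
    (hb : 1 ≤ b) {g : ℕ × ℕ → ℝ} {A : ℝ} (hg : ∀ v, |g v| ≤ A) :
    ∃ B, ∀ v, |potential p q a b g v| ≤ B := by
  obtain ⟨C, r, hC, hr0, hr1, h⟩ := survival_geometric (a := a) (b := b) hp0 hp1 hq0 hq1 ha hb
  have hA : 0 ≤ A := (abs_nonneg _).trans (hg (0, 0))
  refine ⟨∑' t, A * (C * r ^ t), fun v => ?_⟩
  refine tsum_of_norm_bounded (f := fun t => (dtrKilled p q a b ^ t) g v)
    (((summable_geometric_of_lt_one hr0.le hr1).mul_left C).mul_left A).hasSum fun t => ?_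
  have key : ∀ f : ℕ × ℕ → ℝ, (∀ w, f w ≤ A) → (dtrKilled p q a b ^ t) f v ≤ A * (C * r ^ t) := by
    intro f hf
    have h1 := pow_mono_end (dtrKilled_mono (a := a) (b := b) hp0.le hp1 hq0.le hq1) t
      (show f ≤ A • 1 from fun w => by simpa using hf w) v
    rw [map_smul] at h1
    exact h1.trans (mul_le_mul_of_nonneg_left (h t v) hA)
  rw [Real.norm_eq_abs, abs_le']
  refine ⟨key g fun w => (le_abs_self _).trans (hg w), ?_⟩
  have := key (-g) fun w => (neg_le_abs _).trans (hg w)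
  rwa [map_neg] at this

section

variable (hp0 : 0 < p) (hp1 : p ≤ 1) (hq0 : 0 < q) (hq1 : q ≤ 1) (ha : 1 ≤ a) (hb : 2 ≤ b)
include hp0 hp1 hq0 hq1 ha hb

lemma stationaryMean_one : stationaryMean p q a b 1 = 1 :=
  div_self (zero_lt_one.trans_le
    (one_le_potential_one hp0 hp1 hq0 hq1 ha (by omega) (2, 0))).ne'

theorem isDTRStationary_stationaryDist : IsDTRStationary p q a b (stationaryDist p q a b) where
  nonneg v := div_nonneg
    (potential_nonneg hp0 hp1 hq0 hq1 (Pi.single_nonneg.2 zero_le_one) _)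
    (potential_nonneg hp0 hp1 hq0 hq1 zero_le_one _)
  support v hv := by
    have h : potential p q a b (Pi.single v 1) (2, 0) = 0 := by
      unfold potential
      rw [← tsum_zero (α := ℝ) (β := ℕ)]
      refine tsum_congr fun t => ?_
      refine killed_pow_eq_zero_on_aoiStates hb (fun w hw => ?_) t _ (by simp [aoiStates])
      exact Pi.single_eq_of_ne (M := fun _ => ℝ) (by rintro rfl; exact hv hw) 1
    rw [stationaryDist, stationaryMean, h, zero_div]
  total := by
    have := hasSum_stationaryDist (a := a) (b := b) hp0 hp1 hq0 hq1 ha (by omega)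
      (linGrowth_const 1)
    simp only [mul_one] at this
    exact stationaryMean_one hp0 hp1 hq0 hq1 ha hb ▸ this
  balance v' := by
    have := hasSum_stationaryDist (a := a) (b := b) hp0 hp1 hq0 hq1 ha (by omega)
      ((linGrowth_single v').dtrOp (a := a) (b := b) hp0.le hp1 hq0.le hq1)
    rw [stationaryMean_dtrOp hp0 hp1 hq0 hq1 ha (by omega) (linGrowth_single v')] at this
    simpa only [dtrTransition_eq, stationaryDist] using this

/-- Poisson's equation for the indicator of `w` has a bounded solution `h`. Invariance of `π` makes
the integral of `h - P h` vanish, which leaves `π w - c = 0`. -/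
theorem IsDTRStationary.eq_stationaryDist {π : ℕ × ℕ → ℝ} (hπ : IsDTRStationary p q a b π) :
    π = stationaryDist p q a b := by
  funext w
  set c := stationaryDist p q a b w with hc
  have hbd : ∀ v, |(Pi.single w 1 - fun _ => c : ℕ × ℕ → ℝ) v| ≤ 1 + |c| := by
    intro v
    refine (abs_sub _ _).trans (add_le_add ?_ le_rfl)
    by_cases h : v = w
    · subst h; simp
    · simp [h]
  obtain ⟨B, hB⟩ := potential_bounded (a := a) (b := b) (g := Pi.single w 1 - fun _ => c)
    hp0 hp1 hq0 hq1 ha (by omega) hbd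
  have h1 := hπ.hasSum_dtrOp_sub (g := potential p q a b (Pi.single w 1 - fun _ => c))
    hp0.le hp1 hq0.le hq1 hB
  have h2 : ∀ v, potential p q a b (Pi.single w 1 - fun _ => c) v
      - dtrOp p q a b (potential p q a b (Pi.single w 1 - fun _ => c)) v
      = (Pi.single w 1 : ℕ × ℕ → ℝ) v - c := fun v =>
    potential_poisson (a := a) (b := b) hp0 hp1 hq0 hq1 ha (by omega) (linGrowth_single w) v
  rw [show (fun v => π v * (potential p q a b (Pi.single w 1 - fun _ => c) v
      - dtrOp p q a b (potential p q a b (Pi.single w 1 - fun _ => c)) v))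
      = fun v => π v * ((Pi.single w 1 : ℕ × ℕ → ℝ) v - c) from funext fun v => by rw [h2 v]] at h1
  have h3 : HasSum (fun v => π v * (Pi.single w 1 : ℕ × ℕ → ℝ) v) (π w) := by
    have := hasSum_single (f := fun v => π v * (Pi.single w 1 : ℕ × ℕ → ℝ) v) w
      fun v hv => by simp [hv]
    simpa using this
  have h4 := h3.sub (hπ.total.mul_right c)
  have h5 := h4.unique (by simpa only [mul_sub] using h1)
  linarith

/-- A solution of Poisson's equation on the state space determines the stationary mean. -/
theorem stationaryMean_eq_of_poisson {f h : ℕ × ℕ → ℝ} {c : ℝ} (hf : LinGrowth f)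
    (hh : LinGrowth h) (heq : ∀ v ∈ aoiStates, h v - dtrOp p q a b h v = f v - c) :
    stationaryMean p q a b f = c := by
  have hb1 : 1 ≤ b := by omega
  have hst := isDTRStationary_stationaryDist hp0 hp1 hq0 hq1 ha hb
  have h1 := hasSum_stationaryDist (a := a) (b := b) hp0 hp1 hq0 hq1 ha hb1 hh
  have h2 := hasSum_stationaryDist (a := a) (b := b) hp0 hp1 hq0 hq1 ha hb1
    (hh.dtrOp (a := a) (b := b) hp0.le hp1 hq0.le hq1)
  rw [stationaryMean_dtrOp hp0 hp1 hq0 hq1 ha hb1 hh] at h2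
  have h3 := (hasSum_stationaryDist (a := a) (b := b) hp0 hp1 hq0 hq1 ha hb1 hf).sub
    (hst.total.mul_right c)
  have h4 : (fun v => stationaryDist p q a b v * h v
      - stationaryDist p q a b v * dtrOp p q a b h v) = fun v =>
      stationaryDist p q a b v * f v - stationaryDist p q a b v * c := by
    funext v
    by_cases hv : v ∈ aoiStates
    · rw [← mul_sub, ← mul_sub, heq v hv]
    · simp [hst.support v hv]
  have h5 := (h1.sub h2).unique (h4 ▸ h3)
  linarith

end

end Stationary

/-! ### The Markov property of the sample process. -/

section SampleProcess

variable {Ω : Type*} [MeasurableSpace Ω] {μ : Measure Ω} {ISR IRD : ℕ → Ω → Bool}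

omit [MeasurableSpace Ω] in
lemma stateProcess_total_le (θ : ℕ × ℕ → Bool) (ISR IRD : ℕ → Ω → Bool) (v₀ : ℕ × ℕ) (t : ℕ)
    (ω : Ω) : (stateProcess θ ISR IRD v₀ t ω).1 + (stateProcess θ ISR IRD v₀ t ω).2
      ≤ v₀.1 + v₀.2 + t := by
  induction t with
  | zero => simp [stateProcess]
  | succ t ih =>
    simp only [stateProcess, ageStep]
    split_ifs <;> simp_all <;> omega

omit [MeasurableSpace Ω] in
/-- The state process depends on the link states of the earlier slots only. -/
lemma stateProcess_eq_of_agree (θ : ℕ × ℕ → Bool) (ISR IRD : ℕ → Ω → Bool) (v₀ : ℕ × ℕ)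
    (x : ℕ → Bool × Bool) (ω : Ω) (t : ℕ) (hx : ∀ s < t, x s = (ISR s ω, IRD s ω)) :
    stateProcess θ ISR IRD v₀ t ω
      = stateProcess θ (fun s (x : ℕ → Bool × Bool) => (x s).1) (fun s x => (x s).2) v₀ t x := by
  induction t with
  | zero => rfl
  | succ t ih =>
    simp only [stateProcess]
    rw [← ih fun s hs => hx s (by omega), hx t (by omega)]

/-- The state at the beginning of slot `t`, as a function of the link states of the earlier slots. -/
def stateOfHistory (θ : ℕ × ℕ → Bool) (v₀ : ℕ × ℕ) (t : ℕ) (x : Finset.range t → Bool × Bool) :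
    ℕ × ℕ :=
  stateProcess θ (fun s (x : ℕ → Bool × Bool) => (x s).1) (fun s x => (x s).2) v₀ t
    -- The default is never read: the state in slot `t` depends only on the slots before `t`.
    fun s => if h : s ∈ Finset.range t then x ⟨s, h⟩ else (false, false)

omit [MeasurableSpace Ω] in
lemma stateProcess_eq_stateOfHistory (θ : ℕ × ℕ → Bool) (v₀ : ℕ × ℕ) (t : ℕ) :
    stateProcess θ ISR IRD v₀ t = stateOfHistory θ v₀ t ∘
      fun ω (s : Finset.range t) => (ISR s ω, IRD s ω) := by
  funext ω
  refine stateProcess_eq_of_agree θ ISR IRD v₀ _ ω t fun s hs => ?_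
  simp [hs]

variable {p q : ℝ} [IsProbabilityMeasure μ]

omit [IsProbabilityMeasure μ] in
lemma IsLinkModel.measurable_stateProcess (hm : IsLinkModel μ p q ISR IRD) (θ : ℕ × ℕ → Bool)
    (v₀ : ℕ × ℕ) (t : ℕ) : Measurable (stateProcess θ ISR IRD v₀ t) := by
  rw [stateProcess_eq_stateOfHistory]
  exact Measurable.of_discrete.comp
    (measurable_pi_lambda _ fun s => (hm.measurable_sr s).prodMk (hm.measurable_rd s))

omit [IsProbabilityMeasure μ] in
lemma IsLinkModel.indepFun_stateProcess (hm : IsLinkModel μ p q ISR IRD) (θ : ℕ × ℕ → Bool)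
    (v₀ : ℕ × ℕ) (t : ℕ) :
    IndepFun (stateProcess θ ISR IRD v₀ t) (fun ω => (ISR t ω, IRD t ω)) μ := by
  have h := hm.indep.indepFun_finset (Finset.range t) {t} (by simp)
    fun s => (hm.measurable_sr s).prodMk (hm.measurable_rd s)
  have h2 := h.comp (Measurable.of_discrete (f := stateOfHistory θ v₀ t))
    (measurable_pi_apply (⟨t, by simp⟩ : ({t} : Finset ℕ)))
  rw [stateProcess_eq_stateOfHistory]
  exact h2

lemma integral_ite_bool {B : Ω → Bool} (hB : Measurable B) {r : ℝ} (hr : 0 ≤ r)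
    (h : μ {ω | B ω = true} = ENNReal.ofReal r) (x y : ℝ) :
    ∫ ω, (if B ω = true then x else y) ∂μ = r * x + (1 - r) * y := by
  have hs : MeasurableSet {ω | B ω = true} := hB (measurableSet_singleton true)
  have h1 : (fun ω => if B ω = true then x else y)
      = fun ω => Set.indicator {ω | B ω = true} (fun _ => x - y) ω + y := by
    funext ω
    by_cases hω : B ω = true <;> simp [hω]
  rw [h1, integral_add ((integrable_const _).indicator hs) (integrable_const _),
    integral_indicator_const _ hs, measureReal_def, h, ENNReal.toReal_ofReal hr]
  simp
  ring

lemma IsLinkModel.integral_step (hm : IsLinkModel μ p q ISR IRD) (hp0 : 0 ≤ p) (hq0 : 0 ≤ q)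
    (a b : ℕ) (t : ℕ) (g : ℕ × ℕ → ℝ) (v : ℕ × ℕ) :
    ∫ ω, g (ageStep (dtrPolicy a b v) (ISR t ω) (IRD t ω) v) ∂μ = dtrOp p q a b g v := by
  by_cases hv : v.1 ≤ a ∧ b ≤ v.2
  · rw [dtrOp_apply_forward _ hv, ← integral_ite_bool (hm.measurable_rd t) hq0 (hm.prob_rd t)]
    refine integral_congr_ae (ae_of_all _ fun ω => ?_)
    by_cases h : IRD t ω = true <;> simp [ageStep, dtrPolicy, hv, h]
  · rw [dtrOp_apply_receive _ hv, ← integral_ite_bool (hm.measurable_sr t) hp0 (hm.prob_sr t)]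
    refine integral_congr_ae (ae_of_all _ fun ω => ?_)
    have : dtrPolicy a b v = false := by simpa [dtrPolicy] using hv
    by_cases h : ISR t ω = true <;> simp [ageStep, this, h]

/-- By slot `t` the process has visited only a finite box, so every function of the state is
bounded. -/
lemma IsLinkModel.integrable_comp_stateProcess (hm : IsLinkModel μ p q ISR IRD)
    (θ : ℕ × ℕ → Bool) (v₀ : ℕ × ℕ) (t : ℕ) (g : ℕ × ℕ → ℝ) :
    Integrable (fun ω => g (stateProcess θ ISR IRD v₀ t ω)) μ := by
  set N := v₀.1 + v₀.2 + t
  refine Integrable.of_bound (C := ∑ v ∈ Finset.range (N + 1) ×ˢ Finset.range (N + 1), |g v|) ?_ ?_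
  · exact (Measurable.of_discrete.comp (hm.measurable_stateProcess θ v₀ t)).aestronglyMeasurable
  · refine ae_of_all _ fun ω => ?_
    have := stateProcess_total_le θ ISR IRD v₀ t ω
    exact Finset.single_le_sum (f := fun v => |g v|) (fun v _ => abs_nonneg _)
      (by simp only [Finset.mem_product, Finset.mem_range]; omega)

/-- The Markov property, in the mean. -/
lemma IsLinkModel.integral_stateProcess_succ (hm : IsLinkModel μ p q ISR IRD) (hp0 : 0 ≤ p)
    (hq0 : 0 ≤ q) (a b : ℕ) (v₀ : ℕ × ℕ) (t : ℕ) (g : ℕ × ℕ → ℝ) :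
    ∫ ω, g (stateProcess (dtrPolicy a b) ISR IRD v₀ (t + 1) ω) ∂μ
      = ∫ ω, dtrOp p q a b g (stateProcess (dtrPolicy a b) ISR IRD v₀ t ω) ∂μ := by
  set θ := dtrPolicy a b with hθ
  set X := stateProcess θ ISR IRD v₀ t with hX
  set N := v₀.1 + v₀.2 + t
  set S := Finset.range (N + 1) ×ˢ Finset.range (N + 1)
  have hXS : ∀ ω, X ω ∈ S := fun ω => by
    have := stateProcess_total_le θ ISR IRD v₀ t ω
    simp only [S, Finset.mem_product, Finset.mem_range, hX]; omega
  -- Expansion over the finitely many possible states, so that independence of the past and the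
  -- present slot can be used one state at a time.
  have hdec : ∀ (F : ℕ × ℕ → ℝ) (ω : Ω),
      F (X ω) = ∑ v ∈ S, (Pi.single v 1 : ℕ × ℕ → ℝ) (X ω) * F v := by
    intro F ω
    rw [Finset.sum_eq_single_of_mem _ (hXS ω)]
    · simp
    · intro v _ hv
      simp [hv.symm]
  have hint1 : ∀ v, Integrable (fun ω => (Pi.single v 1 : ℕ × ℕ → ℝ) (X ω)) μ := fun v =>
    hm.integrable_comp_stateProcess θ v₀ t _
  have hind : ∀ v, IndepFun (fun ω => (Pi.single v 1 : ℕ × ℕ → ℝ) (X ω))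
      (fun ω => g (ageStep (θ v) (ISR t ω) (IRD t ω) v)) μ := fun v =>
    (hm.indepFun_stateProcess θ v₀ t).comp
      (Measurable.of_discrete (f := (Pi.single v 1 : ℕ × ℕ → ℝ)))
      (Measurable.of_discrete (f := fun x : Bool × Bool => g (ageStep (θ v) x.1 x.2 v)))
  have hint2 : ∀ v, Integrable (fun ω => g (ageStep (θ v) (ISR t ω) (IRD t ω) v)) μ := by
    intro v
    refine Integrable.of_bound (C := ∑ x : Bool × Bool, |g (ageStep (θ v) x.1 x.2 v)|) ?_
      (ae_of_all _ fun ω => Finset.single_le_sum (f := fun x : Bool × Bool =>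
        |g (ageStep (θ v) x.1 x.2 v)|) (fun v _ => abs_nonneg _)
        (Finset.mem_univ (ISR t ω, IRD t ω)))
    exact ((Measurable.of_discrete (f := fun x : Bool × Bool => g (ageStep (θ v) x.1 x.2 v))).comp
      ((hm.measurable_sr t).prodMk (hm.measurable_rd t))).aestronglyMeasurable
  calc ∫ ω, g (stateProcess θ ISR IRD v₀ (t + 1) ω) ∂μ
      = ∫ ω, ∑ v ∈ S, (Pi.single v 1 : ℕ × ℕ → ℝ) (X ω)
          * g (ageStep (θ v) (ISR t ω) (IRD t ω) v) ∂μ := by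
        refine integral_congr_ae (ae_of_all _ fun ω => ?_)
        exact hdec (fun v => g (ageStep (θ v) (ISR t ω) (IRD t ω) v)) ω
    _ = ∑ v ∈ S, (∫ ω, (Pi.single v 1 : ℕ × ℕ → ℝ) (X ω) ∂μ) * dtrOp p q a b g v := by
        rw [integral_finsetSum S (f := fun v ω => (Pi.single v 1 : ℕ × ℕ → ℝ) (X ω)
          * g (ageStep (θ v) (ISR t ω) (IRD t ω) v))
          fun v _ => (hind v).integrable_mul (hint1 v) (hint2 v)]
        refine Finset.sum_congr rfl fun v _ => ?_
        rw [← hm.integral_step hp0 hq0 a b t g v]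
        exact (hind v).integral_mul_eq_mul_integral (hint1 v).aestronglyMeasurable
          (hint2 v).aestronglyMeasurable
    _ = ∫ ω, dtrOp p q a b g (X ω) ∂μ := by
        rw [integral_congr_ae (ae_of_all _ fun ω => hdec (dtrOp p q a b g) ω),
          integral_finsetSum _ fun v _ => (hint1 v).mul_const _]
        exact Finset.sum_congr rfl fun v _ => (integral_mul_const _ _).symm

lemma IsLinkModel.integral_stateProcess (hm : IsLinkModel μ p q ISR IRD) (hp0 : 0 ≤ p)
    (hq0 : 0 ≤ q) (a b : ℕ) (v₀ : ℕ × ℕ) (t : ℕ) (g : ℕ × ℕ → ℝ) :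
    ∫ ω, g (stateProcess (dtrPolicy a b) ISR IRD v₀ t ω) ∂μ = (dtrOp p q a b ^ t) g v₀ := by
  induction t generalizing g with
  | zero => simp [stateProcess]
  | succ t ih =>
    rw [hm.integral_stateProcess_succ hp0 hq0, ih, pow_succ_apply_end']

end SampleProcess

/-! ### Convergence of the time averages. -/

section Ergodic

variable {p q : ℝ} {a b : ℕ} (hp0 : 0 < p) (hp1 : p ≤ 1) (hq0 : 0 < q) (hq1 : q ≤ 1) (ha : 1 ≤ a)
  (hb : 1 ≤ b)
include hp0 hp1 hq0 hq1 ha hb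

/-- The expected total age is bounded in time. -/
lemma dtrOp_pow_totalAge_bounded (v : ℕ × ℕ) : ∃ B, ∀ t, (dtrOp p q a b ^ t) totalAge v ≤ B := by
  set U := potential p q a b totalAge with hU
  have hPm := dtrOp_mono (a := a) (b := b) hp0.le hp1 hq0.le hq1
  have hsU : totalAge ≤ U :=
    le_potential hp0 hp1 hq0 hq1 ha hb totalAge_nonneg linGrowth_totalAge
  obtain ⟨C₀, hC₀, hC⟩ := linGrowth_totalAge.potential (a := a) (b := b) hp0 hp1 hq0 hq1 ha hb
  set C := C₀ + 1
  have hC1 : 1 ≤ C := by simp [C, hC₀]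
  have hUC : ∀ w, U w ≤ C * (totalAge w + 1) := fun w =>
    ((le_abs_self _).trans (hC w)).trans (mul_le_mul_of_nonneg_right (by simp [C])
      (by have := totalAge_nonneg w; linarith))
  set K := U (2, 0) + 1
  have hU0 : 0 ≤ U := fun w => (totalAge_nonneg w).trans (hsU w)
  -- Foster–Lyapunov drift: `P U ≤ U - totalAge + U (2, 0)`, while `U` is at most `C` times
  -- `totalAge + 1`. The resulting affine recursion has fixed point `C * K`.
  have hdrift : ∀ w, dtrOp p q a b U w ≤ (1 - C⁻¹) * U w + K := by
    intro w
    have h1 := potential_eq_add_killed hp0 hp1 hq0 hq1 ha hb linGrowth_totalAge w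
    have h2 := dtrOp_eq_killed_add (p := p) (q := q) (a := a) (b := b) U w
    have h3 : dtrOp p q a b (Pi.single (2, 0) 1) w ≤ 1 := by
      have := hPm (show (Pi.single (2, 0) 1 : ℕ × ℕ → ℝ) ≤ fun _ => 1 from fun u => by
        by_cases h : u = (2, 0)
        · subst h; simp
        · simp [h]) w
      rwa [dtrOp_const] at this
    have h4 := mul_le_mul_of_nonneg_left h3 (hU0 (2, 0))
    have h5 : C⁻¹ * U w ≤ totalAge w + 1 := by
      rw [inv_mul_le_iff₀ (by linarith)]; exact hUC w
    simp only [K]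
    linarith
  have hpow : ∀ t, (dtrOp p q a b ^ t) U v ≤ U v + C * K := by
    have hK : 0 ≤ K := by have := hU0 (2, 0); simp only [Pi.zero_apply] at this; simp only [K]; linarith
    intro t
    induction t with
    | zero => simp; positivity
    | succ t ih =>
      have h1 : (dtrOp p q a b ^ (t + 1)) U v
          ≤ (dtrOp p q a b ^ t) ((1 - C⁻¹) • U + K • 1) v := by
        rw [pow_succ_apply_end']
        exact pow_mono_end hPm t (fun w => by simpa using hdrift w) v
      have h2 : (dtrOp p q a b ^ t) 1 = 1 := by
        clear ih h1
        induction t with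
        | zero => rfl
        | succ t ih => rw [pow_succ_apply_end, ih]; exact dtrOp_const 1
      rw [map_add, map_smul, map_smul, h2] at h1
      simp only [Pi.add_apply, Pi.smul_apply, smul_eq_mul, Pi.one_apply, mul_one] at h1
      have hi : C⁻¹ ≤ 1 := inv_le_one_of_one_le₀ hC1
      have h3 := mul_le_mul_of_nonneg_left ih (sub_nonneg.2 hi)
      have h4 : (1 - C⁻¹) * (U v + C * K) = U v + C * K - C⁻¹ * U v - K := by
        field_simp
        ring
      have h5 : 0 ≤ C⁻¹ * U v := mul_nonneg (by positivity) (hU0 v)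
      linarith
  exact ⟨_, fun t => (pow_mono_end hPm t hsU v).trans (hpow t)⟩

/-- Convergence of the time averages of the expected total age. -/
lemma tendsto_average_dtrOp_pow (v : ℕ × ℕ) :
    Tendsto (fun T : ℕ => 1 / (T : ℝ) * ∑ t ∈ Finset.range T, (dtrOp p q a b ^ t) totalAge v) atTop
      (𝓝 (stationaryMean p q a b totalAge)) := by
  set c := stationaryMean p q a b totalAge with hc
  set h := potential p q a b (totalAge - fun _ => c) with hh
  have hP := potential_poisson (a := a) (b := b) hp0 hp1 hq0 hq1 ha hb linGrowth_totalAge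
  obtain ⟨A, hA, hhA⟩ := (linGrowth_totalAge.sub (linGrowth_const c)).potential (a := a) (b := b)
    hp0 hp1 hq0 hq1 ha hb
  obtain ⟨B, hB⟩ := dtrOp_pow_totalAge_bounded (a := a) (b := b) hp0 hp1 hq0 hq1 ha hb v
  have hPm := dtrOp_mono (a := a) (b := b) hp0.le hp1 hq0.le hq1
  have hone : ∀ t, (dtrOp p q a b ^ t) 1 = 1 := by
    intro t
    induction t with
    | zero => rfl
    | succ t ih => rw [pow_succ_apply_end, ih]; exact dtrOp_const 1
  have hbd : ∀ t, |(dtrOp p q a b ^ t) h v| ≤ A * (B + 1) := by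
    intro t
    have key : ∀ f : ℕ × ℕ → ℝ, (∀ w, f w ≤ A * (totalAge w + 1)) →
        (dtrOp p q a b ^ t) f v ≤ A * (B + 1) := by
      intro f hf
      have h1 := pow_mono_end hPm t (show f ≤ A • (totalAge + 1) from hf) v
      rw [map_smul, map_add, hone] at h1
      exact h1.trans (mul_le_mul_of_nonneg_left (add_le_add (hB t) le_rfl) hA)
    rw [abs_le']
    refine ⟨key h fun w => (le_abs_self _).trans (hhA w), ?_⟩
    have := key (-h) fun w => (neg_le_abs _).trans (hhA w)
    rwa [map_neg] at this
  -- Poisson's equation makes the sum over time telescope, up to `T * c`; the remaining boundary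
  -- terms are bounded in `T`.
  have hfun : totalAge = h - dtrOp p q a b h + c • 1 := by
    funext w
    have := hP w
    simp only [Pi.add_apply, Pi.sub_apply, Pi.smul_apply, smul_eq_mul, Pi.one_apply]
    linarith
  have hstep : ∀ t, (dtrOp p q a b ^ t) totalAge v
      = (dtrOp p q a b ^ t) h v - (dtrOp p q a b ^ (t + 1)) h v + c := by
    intro t
    conv_lhs => rw [hfun]
    rw [map_add, map_sub, map_smul, hone, ← pow_succ_apply_end']
    simp
  have hsum : ∀ T : ℕ, ∑ t ∈ Finset.range T, (dtrOp p q a b ^ t) totalAge v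
      = h v - (dtrOp p q a b ^ T) h v + T * c := by
    intro T
    induction T with
    | zero => simp
    | succ T ih => rw [Finset.sum_range_succ, ih, hstep]; push_cast; ring
  have hlim : Tendsto (fun T : ℕ => 1 / (T : ℝ) * (h v - (dtrOp p q a b ^ T) h v)) atTop (𝓝 0) := by
    refine squeeze_zero_norm (a := fun T : ℕ => (1 / (T : ℝ)) * (|h v| + A * (B + 1))) (fun T => ?_) ?_
    · rw [norm_mul, Real.norm_of_nonneg (by positivity)]
      exact mul_le_mul_of_nonneg_left ((abs_sub _ _).trans (add_le_add le_rfl (hbd T)))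
        (by positivity)
    · simpa using tendsto_one_div_atTop_nhds_zero_nat.mul_const (|h v| + A * (B + 1))
  have hlim2 := hlim.add_const c
  rw [zero_add] at hlim2
  refine hlim2.congr' ?_
  filter_upwards [eventually_gt_atTop 0] with T hT
  have : (T : ℝ) ≠ 0 := by positivity
  rw [hsum]
  field_simp

end Ergodic

/-! ### Explicit solution of Poisson's equation for the split cost. -/

section Poisson

/-- The cost `k + min d b + θ (d - b)⁺` of a state. -/
def splitCost (θ : ℝ) (b : ℕ) (v : ℕ × ℕ) : ℝ :=
  (v.1 : ℝ) + (min v.2 b : ℕ) + θ * (v.2 - b : ℕ)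

lemma splitCost_one (b : ℕ) : splitCost 1 b = totalAge := by
  funext v
  simp only [splitCost, totalAge, one_mul, add_assoc, ← Nat.cast_add]
  congr 2
  omega

lemma splitCost_zero (b : ℕ) (v : ℕ × ℕ) : splitCost 0 b v = (v.1 : ℝ) + (min v.2 b : ℕ) := by
  simp [splitCost]

lemma linGrowth_splitCost (θ : ℝ) (b : ℕ) : LinGrowth (splitCost θ b) := by
  refine ⟨1 + |θ|, by positivity, fun v => ?_⟩
  have h1 : ((min v.2 b : ℕ) : ℝ) ≤ v.2 := by exact_mod_cast min_le_left _ _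
  have h2 : ((v.2 - b : ℕ) : ℝ) ≤ v.2 := by exact_mod_cast Nat.sub_le _ _
  have h3 : |θ| * ((v.2 - b : ℕ) : ℝ) ≤ |θ| * (totalAge v + 1) :=
    mul_le_mul_of_nonneg_left (by unfold totalAge; linarith [Nat.cast_nonneg (α := ℝ) v.1])
      (abs_nonneg _)
  refine (abs_add_le _ _).trans ?_
  rw [abs_mul, Nat.abs_cast, abs_of_nonneg (by positivity), add_mul]
  refine add_le_add ?_ h3
  unfold totalAge
  linarith

/-- The relative value of the state `(1, d)`, `d ≥ b`, per unit of `d`. -/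
noncomputable def loadedSlope (p q θ : ℝ) (a : ℕ) : ℝ :=
  θ * ((1 - (1 - q) ^ a) / q + (1 - q) ^ a / p) / (1 - (1 - q) ^ a)

/-- The relative value of a state with `d < b`, as a function of the total age; `α` is the slope
above `b` and `c` the mean cost. -/
noncomputable def unloadedValue (b : ℕ) (α c : ℝ) (s : ℕ) : ℝ :=
  if b ≤ s then α * ((s : ℝ) - b) else ((b : ℝ) - s) * (b + s - 1) / 2 - c * (b - s)

/-- The relative value of the state `(a + 1 - m, b)`, `m ≤ a`. -/
noncomputable def loadedOffset (q : ℝ) (a b : ℕ) (α c : ℝ) : ℕ → ℝ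
  | 0 => α * (a + 1)
  | m + 1 => (a : ℝ) - m + b - c + q * unloadedValue b α c (a - m + 1)
      + (1 - q) * loadedOffset q a b α c m

/-- A solution of Poisson's equation for the cost `splitCost θ b` with mean `c`. -/
noncomputable def relativeValue (p q θ : ℝ) (a b : ℕ) (c : ℝ) (v : ℕ × ℕ) : ℝ :=
  if v.2 < b then unloadedValue b (1 / p + loadedSlope p q θ a) c (v.1 + v.2)
  else if a < v.1 then
    (1 / p + loadedSlope p q θ a) * v.1 + (θ / p + loadedSlope p q θ a) * (v.2 - b : ℕ)
  else (θ / q + (θ / p + loadedSlope p q θ a - θ / q) * (1 - q) ^ (a + 1 - v.1)) * (v.2 - b : ℕ)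
    + loadedOffset q a b (1 / p + loadedSlope p q θ a) c (a + 1 - v.1)

variable {p q θ c : ℝ} {a b : ℕ}

lemma unloadedValue_of_le {α : ℝ} {s : ℕ} (h : s ≤ b) :
    unloadedValue b α c s = ((b : ℝ) - s) * (b + s - 1) / 2 - c * (b - s) := by
  unfold unloadedValue
  split_ifs with h'
  · obtain rfl : s = b := le_antisymm h h'
    ring
  · rfl

lemma linGrowth_relativeValue (p q θ : ℝ) (a b : ℕ) (c : ℝ) :
    LinGrowth (relativeValue p q θ a b c) := by
  unfold relativeValue
  set α := 1 / p + loadedSlope p q θ a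
  set β := θ / p + loadedSlope p q θ a
  set S1 := ∑ s ∈ Finset.range b, |unloadedValue b α c s| with hS1
  set S2 := ∑ m ∈ Finset.range (a + 2), |loadedOffset q a b α c m| with hS2
  set S3 := ∑ m ∈ Finset.range (a + 2), |θ / q + (β - θ / q) * (1 - q) ^ m| with hS3
  have h1 : 0 ≤ S1 := Finset.sum_nonneg fun _ _ => abs_nonneg _
  have h2 : 0 ≤ S2 := Finset.sum_nonneg fun _ _ => abs_nonneg _
  have h3 : 0 ≤ S3 := Finset.sum_nonneg fun _ _ => abs_nonneg _
  refine ⟨S1 + S2 + S3 + |α| + |β|, by positivity, fun v => ?_⟩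
  have hα := abs_nonneg α
  have hβ := abs_nonneg β
  have hv := totalAge_nonneg v
  have hk : (v.1 : ℝ) ≤ totalAge v + 1 := by
    unfold totalAge; linarith [Nat.cast_nonneg (α := ℝ) v.2]
  have hd : ((v.2 - b : ℕ) : ℝ) ≤ totalAge v + 1 := by
    have : ((v.2 - b : ℕ) : ℝ) ≤ v.2 := by exact_mod_cast Nat.sub_le _ _
    unfold totalAge; linarith [Nat.cast_nonneg (α := ℝ) v.1]
  have hT : 0 ≤ totalAge v + 1 := by linarith
  have e1 := mul_nonneg h1 hT
  have e2 := mul_nonneg h2 hT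
  have e3 := mul_nonneg h3 hT
  have e4 := mul_nonneg hα hT
  have e5 := mul_nonneg hβ hT
  have ex : ∀ x : ℝ, 0 ≤ x → x ≤ x * (totalAge v + 1) := fun x hx => by
    nlinarith [mul_nonneg hx hv]
  have hR : (S1 + S2 + S3 + |α| + |β|) * (totalAge v + 1)
      = S1 * (totalAge v + 1) + S2 * (totalAge v + 1) + S3 * (totalAge v + 1)
        + |α| * (totalAge v + 1) + |β| * (totalAge v + 1) := by ring
  rw [hR]
  beta_reduce
  split_ifs with hlt hak
  · by_cases hs : b ≤ v.1 + v.2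
    · have : |unloadedValue b α c (v.1 + v.2)| ≤ |α| * (totalAge v + 1) := by
        rw [unloadedValue, if_pos hs, abs_mul]
        refine mul_le_mul_of_nonneg_left ?_ hα
        have hs' : (b : ℝ) ≤ ((v.1 + v.2 : ℕ) : ℝ) := by exact_mod_cast hs
        rw [abs_of_nonneg (by linarith)]
        push_cast; unfold totalAge
        linarith [Nat.cast_nonneg (α := ℝ) b]
      linarith
    · have : |unloadedValue b α c (v.1 + v.2)| ≤ S1 :=
        Finset.single_le_sum (f := fun s => |unloadedValue b α c s|) (fun _ _ => abs_nonneg _)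
          (Finset.mem_range.2 (not_le.1 hs))
      linarith [ex S1 h1]
  · refine (abs_add_le _ _).trans ?_
    rw [abs_mul, abs_mul, Nat.abs_cast, Nat.abs_cast]
    linarith [mul_le_mul_of_nonneg_left hk hα, mul_le_mul_of_nonneg_left hd hβ]
  · refine (abs_add_le _ _).trans ?_
    rw [abs_mul, Nat.abs_cast]
    have hm : a + 1 - v.1 ∈ Finset.range (a + 2) := Finset.mem_range.2 (by omega)
    have f1 := Finset.single_le_sum (f := fun m => |loadedOffset q a b α c m|)
      (fun _ _ => abs_nonneg _) hm
    have f2 := Finset.single_le_sum (f := fun m => |θ / q + (β - θ / q) * (1 - q) ^ m|)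
      (fun _ _ => abs_nonneg _) hm
    have f3 := mul_le_mul f2 hd (Nat.cast_nonneg _) h3
    rw [← hS2] at f1
    linarith [ex S2 h2]

lemma one_sub_pow_lt_one (hq0 : 0 < q) (hq1 : q ≤ 1) (ha : 1 ≤ a) : (1 - q) ^ a < 1 :=
  pow_lt_one₀ (by linarith) (by linarith) (by omega)

lemma relativeValue_unloaded {k d : ℕ} (h : d < b) : relativeValue p q θ a b c (k, d)
    = unloadedValue b (1 / p + loadedSlope p q θ a) c (k + d) := if_pos h

lemma relativeValue_high {k e : ℕ} (h : a < k) : relativeValue p q θ a b c (k, b + e)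
    = (1 / p + loadedSlope p q θ a) * k + (θ / p + loadedSlope p q θ a) * e := by
  rw [relativeValue, if_neg (by simp), if_pos h]
  simp

lemma relativeValue_low {k e : ℕ} (h : k ≤ a) : relativeValue p q θ a b c (k, b + e)
    = (θ / q + (θ / p + loadedSlope p q θ a - θ / q) * (1 - q) ^ (a + 1 - k)) * e
      + loadedOffset q a b (1 / p + loadedSlope p q θ a) c (a + 1 - k) := by
  rw [relativeValue, if_neg (by simp), if_neg (by simpa using h)]
  simp

/-- Both formulas for the loaded states agree at `k = a + 1`. -/
lemma relativeValue_low' {k e : ℕ} (h : k ≤ a + 1) : relativeValue p q θ a b c (k, b + e)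
    = (θ / q + (θ / p + loadedSlope p q θ a - θ / q) * (1 - q) ^ (a + 1 - k)) * e
      + loadedOffset q a b (1 / p + loadedSlope p q θ a) c (a + 1 - k) := by
  rcases Nat.lt_or_ge a k with hk | hk
  · obtain rfl : k = a + 1 := by omega
    rw [relativeValue_high hk]
    simp [loadedOffset]
    ring
  · exact relativeValue_low hk

/-- Along `k ≤ a` the slope in `e` obeys `γ = θ + (1 - q) γ'`, with `γ'` the slope at `k + 1` and
the value `θ / p + loadedSlope` at `k = a + 1`. `loadedSlope` is the fixed point for which this
recursion returns it at `k = 1`. The hypothesis `hc` is the matching condition for the constant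
term, forced by the unloaded states of total age at least `b`. -/
lemma relativeValue_one (hq0 : 0 < q) (hq1 : q ≤ 1) (hp0 : 0 < p) (ha : 1 ≤ a)
    (hc : loadedOffset q a b (1 / p + loadedSlope p q θ a) c a
      = -(b - c) / p - (1 - p) * (1 / p + loadedSlope p q θ a) / p) (e : ℕ) :
    relativeValue p q θ a b c (1, b + e) = loadedSlope p q θ a * e
      + (-(b - c) / p - (1 - p) * (1 / p + loadedSlope p q θ a) / p) := by
  rw [relativeValue_low ha, Nat.add_sub_cancel, hc]
  congr 2
  have h := one_sub_pow_lt_one hq0 hq1 ha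
  have h' : 1 - (1 - q) ^ a ≠ 0 := by linarith
  unfold loadedSlope
  field_simp
  ring

/-- For `d < b` and total age `s < b` both outcomes lead to unloaded states of total age `s + 1`,
hence the quadratic. For `s ≥ b` a success reaches the loaded state `(1, s)`, and comparing slopes
gives `1 / p + loadedSlope`. The remaining cases are the receiving and forwarding loaded states, the
latter being the recursion of `loadedOffset`. -/
theorem relativeValue_poisson (hp0 : 0 < p) (hq0 : 0 < q) (hq1 : q ≤ 1) (ha : 1 ≤ a) (hb : 2 ≤ b)
    (hc : loadedOffset q a b (1 / p + loadedSlope p q θ a) c a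
      = -(b - c) / p - (1 - p) * (1 / p + loadedSlope p q θ a) / p) :
    ∀ v ∈ aoiStates, relativeValue p q θ a b c v - dtrOp p q a b (relativeValue p q θ a b c) v
      = splitCost θ b v - c := by
  have hone := relativeValue_one hq0 hq1 hp0 ha hc
  rintro ⟨k, d⟩ hv
  simp only [aoiStates, Set.mem_ofPred_eq] at hv
  rcases Nat.lt_or_ge d b with hd | hd
  · rw [dtrOp_apply_receive _ (by simp; omega)]
    simp only [relativeValue_unloaded hd, splitCost, min_eq_left hd.le, Nat.sub_eq_zero_of_le hd.le]
    rcases Nat.lt_or_ge (k + d) b with hs | hs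
    · rw [relativeValue_unloaded hs, unloadedValue_of_le hs.le,
        unloadedValue_of_le (by omega), unloadedValue_of_le (by omega)]
      push_cast
      ring
    · obtain ⟨e, he⟩ := Nat.exists_eq_add_of_le hs
      rw [he, hone, unloadedValue, unloadedValue, if_pos (by omega), if_pos (by omega)]
      have he' : (k : ℝ) + d = b + e := by exact_mod_cast he
      have hk' : (k : ℝ) = b + e - d := by linarith
      push_cast
      rw [hk']
      field_simp
      ring
  · obtain ⟨e, rfl⟩ := Nat.exists_eq_add_of_le hd
    have hcost : splitCost θ b (k, b + e) = k + b + θ * e := by simp [splitCost]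
    rw [hcost]
    rcases Nat.lt_or_ge a k with hk | hk
    · rw [dtrOp_apply_receive _ (by simp; omega), relativeValue_high hk]
      simp only
      rw [relativeValue_high (show a < k + 1 by omega), show k + (b + e) = b + (k + e) by omega,
        hone]
      push_cast
      field_simp
      ring
    · rw [dtrOp_apply_forward _ (by simp; omega), relativeValue_low hk]
      simp only
      rw [relativeValue_low' (show k + 1 ≤ a + 1 by omega), relativeValue_unloaded (by omega),
        show a + 1 - k = (a - k) + 1 by omega, show a + 1 - (k + 1) = a - k by omega, loadedOffset,
        show a - (a - k) + 1 = k + 1 + 0 by omega, Nat.cast_sub hk, pow_succ]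
      field_simp
      ring

/-- Computing the mean is reduced to checking that a candidate `c` satisfies the one equation `hc`.
-/
theorem stationaryMean_splitCost (hp0 : 0 < p) (hp1 : p ≤ 1) (hq0 : 0 < q) (hq1 : q ≤ 1)
    (ha : 1 ≤ a) (hb : 2 ≤ b)
    (hc : loadedOffset q a b (1 / p + loadedSlope p q θ a) c a
      = -(b - c) / p - (1 - p) * (1 / p + loadedSlope p q θ a) / p) :
    stationaryMean p q a b (splitCost θ b) = c :=
  stationaryMean_eq_of_poisson hp0 hp1 hq0 hq1 ha hb (linGrowth_splitCost θ b)
    (linGrowth_relativeValue p q θ a b c) (relativeValue_poisson hp0 hq0 hq1 ha hb hc)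

/-- For relay age at most `b`, success in forwarding reads the quadratic branch of `unloadedValue`.
The recursion is then solved by a quadratic particular solution plus a geometric term; `k₀` is the
relay age at index `m₀`. -/
lemma loadedOffset_of_quadratic {α : ℝ} (hq0 : 0 < q) {m₀ : ℕ} (hm₀ : a + 1 ≤ b + m₀) (j : ℕ)
    (hj : m₀ + j ≤ a) {k₀ : ℝ} (hk₀ : k₀ = (a : ℝ) + 1 - m₀) :
    loadedOffset q a b α c (m₀ + j)
      = ((b : ℝ) ^ 2 - b + (k₀ - j) - (k₀ - j) ^ 2) / 2 - c * (b - (k₀ - j)) + b / q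
        + (loadedOffset q a b α c m₀
          - (((b : ℝ) ^ 2 - b + k₀ - k₀ ^ 2) / 2 - c * (b - k₀) + b / q)) * (1 - q) ^ j := by
  induction j with
  | zero => simp
  | succ j ih =>
    rw [← add_assoc, loadedOffset, ih (by omega), unloadedValue_of_le (by omega), hk₀]
    have : ((a - (m₀ + j) + 1 : ℕ) : ℝ) = a - (m₀ + j) + 1 := by
      rw [Nat.cast_add, Nat.cast_sub (by omega)]; push_cast; ring
    rw [this, pow_succ]
    push_cast
    field_simp
    ring

/-- For relay age at least `b` the linear branch is read, and the particular solution is affine in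
the relay age `a + 1 - m`. -/
lemma loadedOffset_of_linear {α : ℝ} (hq0 : 0 < q) (m : ℕ) (hm : b + m ≤ a + 1) :
    loadedOffset q a b α c m
      = (1 / q + α) * (a + 1 - m) + ((1 / q - 1 + α + b - c) / q - α * b)
        + (α * (a + 1) - ((1 / q + α) * (a + 1) + ((1 / q - 1 + α + b - c) / q - α * b)))
          * (1 - q) ^ m := by
  induction m with
  | zero => simp [loadedOffset]
  | succ m ih =>
    rw [loadedOffset, ih (by omega), unloadedValue, if_pos (by omega)]
    have : ((a - m + 1 : ℕ) : ℝ) = a - m + 1 := by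
      rw [Nat.cast_add, Nat.cast_sub (by omega)]; push_cast; ring
    rw [this, pow_succ]
    push_cast
    field_simp
    ring

end Poisson

/-! ### Summing the approximate probabilities. -/

section Approx

lemma HasSum.of_eq {ι : Type*} {f g : ι → ℝ} {x y : ℝ} (h : HasSum f x) (hf : ∀ i, g i = f i)
    (hx : y = x) : HasSum g y := by
  rw [funext hf, hx]; exact h

variable {p q : ℝ} {a b : ℕ}

/-- The weighted double negative-binomial sum. -/
lemma hasSum_choose_weighted (hp0 : 0 < p) (hp1 : p ≤ 1) {κ : ℝ} (hκ0 : 0 ≤ κ) (hκ1 : κ < 1)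
    (a : ℕ) :
    HasSum (fun x : ℕ × ℕ => ((x.2 + x.1).choose x.1 : ℝ) * (p * κ) ^ x.1 * (1 - p) ^ x.2
        * ((x.1 : ℝ) * (a + 1) + x.2))
      ((1 - p + p * (a + 1) * κ) / (p ^ 2 * (1 - κ) ^ 2)) := by
  have hy0 : 0 ≤ 1 - p := by linarith
  have hy : ‖1 - p‖ < 1 := by rw [Real.norm_of_nonneg hy0]; linarith
  have hκn : ‖κ‖ < 1 := by rwa [Real.norm_of_nonneg hκ0]
  have hκ : (1 : ℝ) - κ ≠ 0 := by linarith
  have h0 : ∀ l : ℕ, HasSum (fun j : ℕ => ((j + l).choose l : ℝ) * (1 - p) ^ j)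
      (1 / p ^ (l + 1)) := fun l => by
    have := hasSum_choose_mul_geometric_of_norm_lt_one l hy
    rwa [sub_sub_cancel] at this
  -- The term `j = 0` vanishes, and absorbing `j` into the binomial coefficient turns the shifted
  -- series into the unweighted one with `l + 1`.
  have h1 : ∀ l : ℕ, HasSum (fun j : ℕ => ((j + l).choose l : ℝ) * (1 - p) ^ j * j)
      ((l + 1) * (1 - p) / p ^ (l + 2)) := fun l => by
    rw [← hasSum_nat_add_iff' 1]
    simp only [Finset.range_one, Finset.sum_singleton, Nat.cast_zero, mul_zero, sub_zero]
    have := (h0 (l + 1)).mul_left ((l + 1) * (1 - p))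
    rw [mul_one_div] at this
    refine this.of_eq (fun j => ?_) rfl
    have hc : ((j + (l + 1)).choose (l + 1) : ℝ) * (l + 1) = ((j + 1 + l).choose l : ℝ) * (j + 1) := by
      have := Nat.choose_succ_right_eq (j + 1 + l) l
      rw [Nat.add_sub_cancel, show j + 1 + l = j + (l + 1) by omega] at this
      rw [show j + 1 + l = j + (l + 1) by omega]
      exact_mod_cast this
    rw [pow_succ]
    push_cast
    linear_combination (-(1 - p) ^ (j + 1)) * hc
  have h2 : ∀ l : ℕ, HasSum (fun j : ℕ => ((j + l).choose l : ℝ) * (p * κ) ^ l * (1 - p) ^ j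
      * ((l : ℝ) * (a + 1) + j))
      (κ ^ l * l * ((a + 1) / p + (1 - p) / p ^ 2) + κ ^ l * ((1 - p) / p ^ 2)) := fun l => by
    have := (((h0 l).mul_right ((l : ℝ) * (a + 1))).add (h1 l)).mul_left ((p * κ) ^ l)
    refine this.of_eq (fun j => ?_) ?_
    · ring
    · rw [mul_pow, pow_add p l 1, pow_add p l 2]
      field_simp
      ring
  have h3 : HasSum (fun l : ℕ => κ ^ l * l * ((a + 1) / p + (1 - p) / p ^ 2)
      + κ ^ l * ((1 - p) / p ^ 2)) ((1 - p + p * (a + 1) * κ) / (p ^ 2 * (1 - κ) ^ 2)) := by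
    have e1 := (hasSum_coe_mul_geometric_of_norm_lt_one hκn).mul_right
      (((a : ℝ) + 1) / p + (1 - p) / p ^ 2)
    have e2 := (hasSum_geometric_of_lt_one hκ0 hκ1).mul_right ((1 - p) / p ^ 2)
    refine (e1.add e2).of_eq (fun l => ?_) ?_
    · ring
    · field_simp
      ring
  have hs : Summable (fun x : ℕ × ℕ => ((x.2 + x.1).choose x.1 : ℝ) * (p * κ) ^ x.1
      * (1 - p) ^ x.2 * ((x.1 : ℝ) * (a + 1) + x.2)) := by
    rw [summable_prod_of_nonneg fun x => by
      simp only [Pi.zero_apply]; have := mul_nonneg hp0.le hκ0; positivity]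
    exact ⟨fun l => (h2 l).summable, by simpa only [(h2 _).tsum_eq] using h3.summable⟩
  rw [h3.unique (hs.hasSum.prod_fiberwise h2)]
  exact hs.hasSum

/-- The sum over `l` in the approximate probabilities. -/
noncomputable def approxCoeff (p κ : ℝ) (a e : ℕ) : ℝ :=
  ∑ l ∈ Finset.range (e / (a + 1) + 1),
    ((e - l * (a + 1) + l).choose l : ℝ) * (p * κ) ^ l * (1 - p) ^ (e - l * (a + 1))

lemma approxCoeff_nonneg (hp0 : 0 < p) (hp1 : p ≤ 1) {κ : ℝ} (hκ0 : 0 ≤ κ) (a e : ℕ) :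
    0 ≤ approxCoeff p κ a e := by
  have h := sub_nonneg.2 hp1
  unfold approxCoeff
  positivity

/-- The substitution `e = l (a + 1) + j` turns the constraint `l ≤ e / (a + 1)` into a free sum over
all `(l, j)`. -/
lemma hasSum_approxCoeff (hp0 : 0 < p) (hp1 : p ≤ 1) {κ : ℝ} (hκ0 : 0 ≤ κ) (hκ1 : κ < 1) (a : ℕ) :
    HasSum (fun e : ℕ => (e : ℝ) * approxCoeff p κ a e)
      ((1 - p + p * (a + 1) * κ) / (p ^ 2 * (1 - κ) ^ 2)) := by
  set G : ℕ × ℕ → ℝ := fun x => if x.2 * (a + 1) ≤ x.1 then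
    ((x.1 - x.2 * (a + 1) + x.2).choose x.2 : ℝ) * (p * κ) ^ x.2 * (1 - p) ^ (x.1 - x.2 * (a + 1))
      * x.1 else 0 with hG
  have hinj : Function.Injective fun x : ℕ × ℕ => (x.1 * (a + 1) + x.2, x.1) := by
    rintro ⟨l, j⟩ ⟨l', j'⟩ h
    simp only [Prod.mk.injEq] at h
    obtain ⟨h1, rfl⟩ := h
    simpa using h1
  have h1 : HasSum G ((1 - p + p * (a + 1) * κ) / (p ^ 2 * (1 - κ) ^ 2)) := by
    rw [← hinj.hasSum_iff]
    · refine (hasSum_choose_weighted hp0 hp1 hκ0 hκ1 a).of_eq (fun x => ?_) rfl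
      simp [hG]
    · rintro ⟨e, l⟩ hx
      simp only [hG]
      refine if_neg fun h => hx ⟨(l, e - l * (a + 1)), ?_⟩
      simp only [Prod.mk.injEq, and_true]
      omega
  refine h1.prod_fiberwise fun e => ?_
  have h2 : HasSum (fun l => G (e, l)) _ := hasSum_sum_of_ne_finset_zero
    (s := Finset.range (e / (a + 1) + 1)) fun l hl => if_neg fun h => hl (by
      rw [Finset.mem_range, Nat.lt_succ_iff, Nat.le_div_iff_mul_le (by omega)]; exact h)
  refine h2.of_eq (fun _ => rfl) ?_
  rw [approxCoeff, Finset.mul_sum]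
  refine Finset.sum_congr rfl fun l hl => ?_
  rw [Finset.mem_range, Nat.lt_succ_iff, Nat.le_div_iff_mul_le (by omega)] at hl
  simp only [hG, if_pos hl]
  ring

lemma dtrApproxRow_eq (e : ℕ) : dtrApproxRow p q a b (b + e)
    = dtrInitial p q a b * approxCoeff p ((1 - q) ^ a) a e := by
  unfold dtrApproxRow approxCoeff
  rw [Nat.add_sub_cancel_left]
  congr 1
  refine Finset.sum_congr rfl fun l hl => ?_
  rw [Finset.mem_range, Nat.lt_succ_iff] at hl
  have hN : dtrN a b (b + e) l = e - l * (a + 1) + 1 := by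
    unfold dtrN
    rw [Nat.add_sub_cancel_left, Nat.sub_mul]
    have h1 := Nat.div_add_mod' e (a + 1)
    have h2 := Nat.mul_le_mul_right (a + 1) hl
    omega
  rw [hN, Nat.add_sub_cancel, show e - l * (a + 1) + 1 + l - 1 = e - l * (a + 1) + l by omega,
    Nat.add_choose, mul_comm (l ! : ℝ), Nat.cast_div (Nat.factorial_mul_factorial_dvd_factorial_add _ _)
    (by positivity)]
  push_cast
  rfl

/-- The factor of the approximate probabilities that depends on the age at the relay. -/
noncomputable def relayWeight (p q : ℝ) (a k : ℕ) : ℝ :=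
  if 1 ≤ k then
    if k ≤ a + 1 then (1 - q) ^ (k - 1) else (1 - q) ^ a * (1 - p) ^ (k - a - 1)
  else 0

lemma hasSum_relayWeight (hp0 : 0 < p) (hp1 : p ≤ 1) (hq0 : 0 < q) (a : ℕ) :
    HasSum (relayWeight p q a) ((1 - (1 - q) ^ a) / q + (1 - q) ^ a / p) := by
  rw [← hasSum_nat_add_iff' (a + 1)]
  have h1 : ∑ k ∈ Finset.range (a + 1), relayWeight p q a k = (1 - (1 - q) ^ a) / q := by
    rw [Finset.sum_range_succ']
    have : ∀ k ∈ Finset.range a, relayWeight p q a (k + 1) = (1 - q) ^ k := fun k hk => by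
      rw [Finset.mem_range] at hk
      rw [relayWeight, if_pos (by omega), if_pos (by omega), Nat.add_sub_cancel]
    rw [Finset.sum_congr rfl this, geom_sum_eq (by linarith)]
    simp only [relayWeight]
    rw [if_neg (by omega), add_zero, ← neg_div_neg_eq]
    ring
  rw [h1, add_sub_cancel_left]
  have h2 := (hasSum_geometric_of_lt_one (sub_nonneg.2 hp1) (by linarith)).mul_left ((1 - q) ^ a)
  rw [sub_sub_cancel, ← div_eq_mul_inv] at h2
  refine h2.of_eq (fun k => ?_) rfl
  rw [relayWeight, if_pos (by omega)]
  split_ifs with h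
  · obtain rfl : k = 0 := by omega
    simp
  · rw [show k + (a + 1) - a - 1 = k by omega]

/-- The contribution of the excess of the age gain under the approximate probabilities. -/
theorem hasSum_dtrApprox (hp0 : 0 < p) (hp1 : p ≤ 1) (hq0 : 0 < q) (hq1 : q ≤ 1) (ha : 1 ≤ a) :
    HasSum (fun v : ℕ × ℕ => ((v.2 : ℝ) - b) * dtrApprox p q a b v)
      (((1 - (1 - q) ^ a) / q + (1 - q) ^ a / p) * (dtrInitial p q a b
        * ((1 - p + p * (a + 1) * (1 - q) ^ a) / (p ^ 2 * (1 - (1 - q) ^ a) ^ 2)))) := by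
  have hκ0 : 0 ≤ (1 - q) ^ a := pow_nonneg (by linarith) _
  have hκ1 := one_sub_pow_lt_one hq0 hq1 ha
  set R : ℕ → ℝ := fun d => if b ≤ d then ((d - b : ℕ) : ℝ)
    * approxCoeff p ((1 - q) ^ a) a (d - b) else 0 with hR
  have hRsum : HasSum R ((1 - p + p * (a + 1) * (1 - q) ^ a) / (p ^ 2 * (1 - (1 - q) ^ a) ^ 2)) := by
    rw [← hasSum_nat_add_iff' b, Finset.sum_eq_zero, sub_zero]
    · refine (hasSum_approxCoeff hp0 hp1 hκ0 hκ1 a).of_eq (fun e => ?_) rfl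
      simp [hR]
    · intro d hd
      exact if_neg (by simpa using hd)
  have hW := hasSum_relayWeight hp0 hp1 hq0 a
  have hW0 : 0 ≤ relayWeight p q a := fun k => by
    have := sub_nonneg.2 hp1
    have := sub_nonneg.2 hq1
    simp only [Pi.zero_apply, relayWeight]
    split_ifs <;> positivity
  have hR0 : 0 ≤ R := fun d => by
    simp only [Pi.zero_apply, hR]
    split_ifs
    · exact mul_nonneg (Nat.cast_nonneg _) (approxCoeff_nonneg hp0 hp1 hκ0 _ _)
    · exact le_rfl
  -- The approximation is a product of a factor in `k` and one in `d`, so the double sum factorizes;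
  -- for `d < b` it is zero, whatever the sign of `d - b`.
  have h := (hW.mul hRsum (hW.summable.mul_of_nonneg hRsum.summable hW0 hR0)).mul_left
    (dtrInitial p q a b)
  refine h.of_eq (fun ⟨k, d⟩ => ?_) ?_
  · simp only [dtrApprox, relayWeight, hR]
    by_cases hk : 1 ≤ k
    · by_cases hd : b ≤ d
      · obtain ⟨e, rfl⟩ := Nat.exists_eq_add_of_le hd
        simp only [hk, hd, and_self, if_true, dtrApproxRow_eq, Nat.add_sub_cancel_left]
        push_cast
        split_ifs <;> ring
      · simp [hd]
    · simp [hk]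
  · ring

end Approx

/-! ### The closed forms and the limit `q → 1`. -/

section ClosedForms

variable {p q : ℝ} {a b : ℕ}

/-- When `a ≤ b - 1` the recursion for the loaded states stays in the quadratic branch from its
first step. -/
theorem stationaryMean_totalAge_exact (hp0 : 0 < p) (hp1 : p ≤ 1) (hq0 : 0 < q) (hq1 : q ≤ 1)
    (ha : 1 ≤ a) (hb : 2 ≤ b) (hab : a ≤ b - 1) :
    stationaryMean p q a b totalAge = aoiExactFormula p q a b := by
  rw [← splitCost_one b]
  refine stationaryMean_splitCost hp0 hp1 hq0 hq1 ha hb ?_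
  have h := loadedOffset_of_quadratic (a := a) (c := aoiExactFormula p q a b) (b := b)
    (α := 1 / p + loadedSlope p q 1 a) hq0 (m₀ := 0) (by omega) a (by omega) rfl
  rw [zero_add] at h
  rw [h]
  have hκ1 := one_sub_pow_lt_one hq0 hq1 ha
  have hκ0 : 0 ≤ (1 - q) ^ a := pow_nonneg (by linarith) _
  simp only [loadedOffset, loadedSlope, aoiExactFormula]
  set κ := (1 - q) ^ a
  have e1 : 1 - κ ≠ 0 := by linarith
  have hab' : (a : ℝ) + 1 ≤ b := by exact_mod_cast (by omega : a + 1 ≤ b)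
  have e2 : 1 - p + p * b - p * ((b : ℝ) - a - 1) * κ ≠ 0 := by
    have h1 : p * ((b : ℝ) - a - 1) * κ ≤ p * ((b : ℝ) - a - 1) * 1 :=
      mul_le_mul_of_nonneg_left hκ1.le (mul_nonneg hp0.le (by linarith))
    have h2 : 0 < p * ((a : ℝ) + 1) := by positivity
    linarith
  -- The denominator is kept as an opaque nonzero quantity while fractions are cleared, and expanded
  -- only for the final polynomial identity.
  generalize hDd : 1 - p + p * b - p * ((b : ℝ) - a - 1) * κ = D at *
  push_cast
  field_simp
  rw [← hDd]
  ring

/-- The normalizing denominator in the case `b - 1 ≤ a`. -/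
noncomputable def dtrDenom (p q : ℝ) (a b : ℕ) : ℝ :=
  q * (1 - p) + p * q * b + p * (1 - q) ^ (b - 1) - p * (1 - q) ^ a

lemma dtrDenom_pos (hp0 : 0 < p) (hp1 : p ≤ 1) (hq0 : 0 < q) (hq1 : q ≤ 1) (hb : 2 ≤ b)
    (hab : b - 1 ≤ a) : 0 < dtrDenom p q a b := by
  have h1 : (1 - q) ^ a ≤ (1 - q) ^ (b - 1) :=
    pow_le_pow_of_le_one (by linarith) (by linarith) hab
  have h2 : 0 < p * q * b := by positivity
  have h3 := mul_nonneg hq0.le (sub_nonneg.2 hp1)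
  have h4 := mul_le_mul_of_nonneg_left h1 hp0.le
  unfold dtrDenom
  linarith

/-- The mean of `splitCost θ b` in the case `b - 1 ≤ a`, in terms of the slope `α`. -/
noncomputable def splitMean (p q : ℝ) (a b : ℕ) (α : ℝ) : ℝ :=
  p * q * (((b : ℝ) ^ 2 - b) / 2 + b / q + (1 - q) ^ (b - 1) * (1 / q - 1 + α + b) / q
    - (1 - q) ^ a * ((a + 1) / q + (1 / q - 1 + α + b) / q - α * b) + b / p + (1 - p) * α / p)
    / dtrDenom p q a b

/-- The recursion runs in the linear branch down to relay age `b`, then `b - 1` further steps in the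
quadratic one. The weight `θ` enters only through the slope `α`, so one formula covers both the true
and the truncated age. -/
theorem stationaryMean_splitCost_eq (hp0 : 0 < p) (hp1 : p ≤ 1) (hq0 : 0 < q) (hq1 : q ≤ 1)
    (ha : 1 ≤ a) (hb : 2 ≤ b) (hab : b - 1 ≤ a) (θ : ℝ) :
    stationaryMean p q a b (splitCost θ b) = splitMean p q a b (1 / p + loadedSlope p q θ a) := by
  refine stationaryMean_splitCost hp0 hp1 hq0 hq1 ha hb ?_
  have hD := (dtrDenom_pos hp0 hp1 hq0 hq1 hb hab).ne'
  generalize 1 / p + loadedSlope p q θ a = α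
  have h := loadedOffset_of_quadratic (a := a) (c := splitMean p q a b α) (b := b) (α := α) hq0
    (m₀ := a + 1 - b) (k₀ := b) (by omega) (b - 1) (by omega)
    (by rw [Nat.cast_sub (by omega)]; push_cast; ring)
  rw [show a + 1 - b + (b - 1) = a by omega, loadedOffset_of_linear hq0 (a + 1 - b) (by omega),
    Nat.cast_sub (by omega), Nat.cast_sub (by omega)] at h
  rw [h]
  have hpow : (1 - q) ^ a = (1 - q) ^ (a + 1 - b) * (1 - q) ^ (b - 1) := by
    rw [← pow_add]; congr 1; omega
  rw [splitMean]
  unfold dtrDenom at *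
  rw [hpow] at hD ⊢
  generalize (1 - q) ^ (b - 1) = Y at *
  generalize (1 - q) ^ (a + 1 - b) = Z at *
  generalize hDd : q * (1 - p) + p * q * b + p * Y - p * (Z * Y) = D at *
  push_cast
  field_simp
  rw [← hDd]
  ring

lemma dtrInitial_eq (hab : b - 1 ≤ a) (hb : 2 ≤ b) (hq0 : 0 < q) :
    dtrInitial p q a b = p ^ 2 * q * (1 - (1 - q) ^ (b - 1)) / dtrDenom p q a b := by
  have hpow : (1 - q) ^ (b - 1) * (1 - q) ^ (a + 1 - b) = (1 - q) ^ a := by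
    rw [← pow_add]; congr 1; omega
  unfold dtrInitial dtrX dtrDenom
  rw [show p * (1 - q) ^ (b - 1) * (1 - (1 - q) ^ (a + 1 - b))
    = p * (1 - q) ^ (b - 1) - p * (1 - q) ^ a by rw [← hpow]; ring, ← add_sub_assoc]
  generalize q * (1 - p) + p * q * b + p * (1 - q) ^ (b - 1) - p * (1 - q) ^ a = D
  field_simp

/-- The contribution of the excess of the age gain over `b` to the approximate mean age. -/
noncomputable def approxExcess (p q : ℝ) (a b : ℕ) : ℝ :=
  ((1 - (1 - q) ^ a) / q + (1 - q) ^ a / p) * (p ^ 2 * q * (1 - (1 - q) ^ (b - 1)) / dtrDenom p q a b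
    * ((1 - p + p * (a + 1) * (1 - q) ^ a) / (p ^ 2 * (1 - (1 - q) ^ a) ^ 2)))

lemma splitMean_add_approxExcess (hp0 : 0 < p) (hp1 : p ≤ 1) (hq0 : 0 < q) (hq1 : q ≤ 1)
    (ha : 1 ≤ a) (hb : 2 ≤ b) (hab : b - 1 ≤ a) :
    splitMean p q a b (1 / p) + approxExcess p q a b = aoiApproxFormula p q a b := by
  have hD := (dtrDenom_pos hp0 hp1 hq0 hq1 hb hab).ne'
  have hκ1 := one_sub_pow_lt_one hq0 hq1 ha
  unfold splitMean approxExcess aoiApproxFormula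
  unfold dtrDenom at *
  generalize (1 - q) ^ (b - 1) = Y at *
  generalize (1 - q) ^ a = κ at *
  have e1 : 1 - κ ≠ 0 := by linarith
  generalize hDd : q * (1 - p) + p * q * b + p * Y - p * κ = D at *
  field_simp
  rw [← hDd]
  ring

/-- The exact mean age minus the approximate one is explicit, and it vanishes as `q → 1`. -/
lemma tendsto_splitMean_sub (hp0 : 0 < p) (hp1 : p ≤ 1) (ha : 1 ≤ a) (hb : 2 ≤ b)
    (hab : b - 1 ≤ a) :
    Tendsto (fun q : ℝ => splitMean p q a b (1 / p + loadedSlope p q 1 a)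
      - (splitMean p q a b (1 / p) + approxExcess p q a b)) (𝓝[≤] 1) (𝓝 0) := by
  have hD := (dtrDenom_pos (q := 1) hp0 hp1 one_pos le_rfl hb hab).ne'
  have ha0 : a ≠ 0 := by omega
  have hb0 : b - 1 ≠ 0 := by omega
  have hcont : ContinuousAt (fun q : ℝ => splitMean p q a b (1 / p + loadedSlope p q 1 a)
      - (splitMean p q a b (1 / p) + approxExcess p q a b)) 1 := by
    unfold splitMean approxExcess loadedSlope
    unfold dtrDenom at *
    fun_prop (disch := first | exact hD | simp [ha0, hp0.ne'])
  have hval : splitMean p 1 a b (1 / p + loadedSlope p 1 1 a)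
      - (splitMean p 1 a b (1 / p) + approxExcess p 1 a b) = 0 := by
    unfold splitMean approxExcess loadedSlope
    unfold dtrDenom at *
    simp only [sub_self, zero_pow ha0, zero_pow hb0] at *
    field_simp
    ring
  have := hcont.tendsto
  rw [hval] at this
  -- The filter `𝓝[≤] 1` includes the point `1`, so the limit also contains equality at `q = 1`.
  exact this.mono_left nhdsWithin_le_nhds

end ClosedForms

theorem theorem4 {p : ℝ} (hp0 : 0 < p) (hp1 : p ≤ 1) {δ₁ δ₂ : ℕ} (hδ₁ : 1 ≤ δ₁) (hδ₂ : 2 ≤ δ₂) :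
    ∃ (π : ℝ → ℕ × ℕ → ℝ) (Δ : ℝ → ℝ),
      (∀ q : ℝ, 0 < q → q ≤ 1 →
        -- `π q` is the unique stationary distribution, and `Δ q` is the mean age under it
        IsDTRStationary p q δ₁ δ₂ (π q) ∧
        (∀ π' : ℕ × ℕ → ℝ, IsDTRStationary p q δ₁ δ₂ π' → π' = π q) ∧
        HasSum (fun v : ℕ × ℕ => ((v.1 : ℝ) + v.2) * π q v) (Δ q) ∧
        -- `Δ q` is the long-run average AoI, from every initial state
        (∀ (Ω : Type*) [MeasurableSpace Ω] (μ : Measure Ω) [IsProbabilityMeasure μ]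
          (ISR IRD : ℕ → Ω → Bool) (v₀ : ℕ × ℕ), IsLinkModel μ p q ISR IRD → v₀ ∈ aoiStates →
            (∀ t, Integrable (destAge (dtrPolicy δ₁ δ₂) ISR IRD v₀ t) μ) ∧
            Tendsto (fun T : ℕ => meanAge μ (dtrPolicy δ₁ δ₂) ISR IRD v₀ T) atTop (𝓝 (Δ q)) ∧
            averageAoI μ (dtrPolicy δ₁ δ₂) ISR IRD v₀ = Δ q) ∧
        -- the exact closed form
        (δ₁ ≤ δ₂ - 1 → Δ q = aoiExactFormula p q δ₁ δ₂) ∧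
        -- the approximate closed form: the mean age with `π q` replaced by its approximation in
        -- the contribution of the excess `d - δ₂` of the age gain over the threshold
        (δ₂ - 1 ≤ δ₁ →
          HasSum (fun v : ℕ × ℕ => ((v.1 : ℝ) + (min v.2 δ₂ : ℕ)) * π q v
              + ((v.2 : ℝ) - δ₂) * dtrApprox p q δ₁ δ₂ v)
            (aoiApproxFormula p q δ₁ δ₂))) ∧
      -- the approximation becomes exact as `q → 1`
      (δ₂ - 1 ≤ δ₁ →
        Tendsto (fun q : ℝ => Δ q - aoiApproxFormula p q δ₁ δ₂) (𝓝[≤] 1) (𝓝 0)) := by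
  have hb1 : 1 ≤ δ₂ := by omega
  refine ⟨fun q => stationaryDist p q δ₁ δ₂, fun q => stationaryMean p q δ₁ δ₂ totalAge,
    fun q hq0 hq1 => ⟨isDTRStationary_stationaryDist hp0 hp1 hq0 hq1 hδ₁ hδ₂,
      fun π' h => h.eq_stationaryDist hp0 hp1 hq0 hq1 hδ₁ hδ₂, ?_, ?_,
      stationaryMean_totalAge_exact hp0 hp1 hq0 hq1 hδ₁ hδ₂, fun hab => ?_⟩, fun hab => ?_⟩
  · exact (hasSum_stationaryDist hp0 hp1 hq0 hq1 hδ₁ hb1 linGrowth_totalAge).of_eq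
      (fun v => mul_comm _ _) rfl
  · intro Ω _ μ _ ISR IRD v₀ hm _
    have hint := fun t => hm.integrable_comp_stateProcess (dtrPolicy δ₁ δ₂) v₀ t totalAge
    have hmean : ∀ T : ℕ, meanAge μ (dtrPolicy δ₁ δ₂) ISR IRD v₀ T
        = 1 / (T : ℝ) * ∑ t ∈ Finset.range T, (dtrOp p q δ₁ δ₂ ^ t) totalAge v₀ := by
      intro T
      unfold meanAge
      congr 1
      refine (integral_finsetSum _ fun t _ => hint t).trans (Finset.sum_congr rfl fun t _ => ?_)
      exact hm.integral_stateProcess hp0.le hq0.le δ₁ δ₂ v₀ t totalAge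
    have hlim : Tendsto (fun T : ℕ => meanAge μ (dtrPolicy δ₁ δ₂) ISR IRD v₀ T) atTop
        (𝓝 (stationaryMean p q δ₁ δ₂ totalAge)) := by
      simp only [hmean]
      exact tendsto_average_dtrOp_pow hp0 hp1 hq0 hq1 hδ₁ hb1 v₀
    exact ⟨hint, hlim, hlim.limsup_eq⟩
  · have h1 := hasSum_stationaryDist hp0 hp1 hq0 hq1 hδ₁ hb1 (linGrowth_splitCost 0 δ₂)
    have h2 := hasSum_dtrApprox (b := δ₂) hp0 hp1 hq0 hq1 hδ₁
    -- At `θ = 0` the slope `loadedSlope` vanishes, so the stationary part is `splitMean` at `1 /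
    -- p`.
    refine (h1.add h2).of_eq (fun v => by rw [splitCost_zero]; ring) ?_
    rw [stationaryMean_splitCost_eq hp0 hp1 hq0 hq1 hδ₁ hδ₂ hab, dtrInitial_eq hab hδ₂ hq0,
      ← splitMean_add_approxExcess hp0 hp1 hq0 hq1 hδ₁ hδ₂ hab]
    simp [loadedSlope, approxExcess]
  · refine (tendsto_splitMean_sub hp0 hp1 hδ₁ hδ₂ hab).congr' ?_
    filter_upwards [self_mem_nhdsWithin,
      nhdsWithin_le_nhds (Ioi_mem_nhds (zero_lt_one (α := ℝ)))] with q hq1 hq0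
    rw [splitMean_add_approxExcess hp0 hp1 hq0 hq1 hδ₁ hδ₂ hab,
      ← stationaryMean_splitCost_eq hp0 hp1 hq0 hq1 hδ₁ hδ₂ hab, splitCost_one]
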